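/- Let $m\ge 1$ and let $M$ be a smooth manifold of dimension $2m$ with a Riemannian metric $g$ and Levi-Civita connection $\nabla$. Let $F$ be a smooth $(1,1)$ tensor field on $M$ such that $(M,F,g)$ is a para-Kähler-Norden manifold, i.e. $F^2=\mathrm{id}$, the eigenbundles of $F$ for the eigenvalues $1$ and $-1$ have the same rank, $g(FX,Y)=g(X,FY)$ for all vector fields $X,Y$, and $\nabla F=0$. Let $V$ be a smooth vector field on $M$ with $g(V,V)=1$ and $\nabla V=0$, and let $\alpha:M\to(0,\infty)$ be a smooth function with $(FV)(\alpha)=0$. Define a Riemannian metric on $M$ by $$g^{\alpha}(X,Y)=\alpha\big(g(X,Y)+g(X,FV)\,g(Y,FV)\big).$$ For a smooth map $\phi:(M,g_1)\to(N,g_2)$ of Riemannian manifolds with pull-back connection $\nabla^{\phi}$ on $\phi^{-1}TN$, the tension field is $\tau(\phi)=\mathrm{Tr}_{g_1}\nabla d\phi$ and the bitension field is $\tau_2(\phi)=\Delta^{\phi}\tau(\phi)-\mathrm{Tr}_{g_1}R^{N}(\tau(\phi),d\phi)d\phi$, where $\Delta^{\phi}=-\mathrm{Tr}_{g_1}(\nabla^{\phi}_{*}\nabla^{\phi}_{*}-\nabla^{\phi}_{\nabla_{*}*})$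 and $R^N(X,Y)Z=\nabla^N_X\nabla^N_YZ-\nabla^N_Y\nabla^N_XZ-\nabla^N_{[X,Y]}Z$. The map $\phi$ is harmonic if $\tau(\phi)=0$, biharmonic if $\tau_2(\phi)=0$, and proper biharmonic if it is biharmonic and not harmonic. With all operations taken with respect to $g$, put $\Delta^{I}\,\mathrm{grad}\,\alpha=-\mathrm{Tr}_g(\nabla_*\nabla_*-\nabla_{\nabla_**})\,\mathrm{grad}\,\alpha$, $\Delta(\alpha)=\mathrm{Tr}_g\,\mathrm{Hess}_\alpha$ (where $\mathrm{Hess}_\alpha(X,Y)=g(\nabla_X\mathrm{grad}\,\alpha,Y)$), $\mathrm{Ricci}(X)=\sum_i R(X,e_i)e_i$ for a $g$-orthonormal frame $(e_i)$, and $$B=\Delta^{I}\mathrm{grad}\,\alpha-\mathrm{Ricci}(\mathrm{grad}\,\alpha)-\frac{m-5}{\alpha}\nabla_{\mathrm{grad}\,\alpha}\mathrm{grad}\,\alpha+2\Big(\frac{(m-4)\|\mathrm{grad}\,\alpha\|^2}{\alpha^2}+\frac{\Delta(\alpha)}{\alpha}\Big)\mathrm{grad}\,\alpha-\frac12\nabla_{FV}\nabla_{FV}\mathrm{grad}\,\alpha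 .$$ Then the identity map $I:(M,g^{\alpha})\to(M,g)$ satisfies: 1. its bitension field is $\tau_2(I)=\dfrac{m-1}{\alpha^3}\,B$; 2. $I$ is biharmonic if and only if $m=1$ or $B=0$ on $M$; 3. if $M$ is connected, $I$ is proper biharmonic if and only if $\alpha$ is not constant, $m\neq 1$ and $B=0$ on $M$. -/

import Mathlib

open scoped Manifold ContDiff

noncomputable section

namespace RiemannianMaps

/-- A smooth Riemannian metric on the manifold `M` modelled on `E`. -/
abbrev Metric (E : Type*) [NormedAddCommGroup E] [NormedSpace ℝ E]
    (M : Type*) [TopologicalSpace M] [ChartedSpace E M] [IsManifold 𝓘(ℝ, E) ∞ M] :=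
  Bundle.ContMDiffRiemannianMetric 𝓘(ℝ, E) ∞ E (TangentSpace 𝓘(ℝ, E) : M → Type _)

/-- A covariant derivative on the tangent bundle of `M`; `cov Y x u` is `∇_u Y` at `x`. -/
abbrev Connection (E : Type*) [NormedAddCommGroup E] [NormedSpace ℝ E]
    (M : Type*) [TopologicalSpace M] [ChartedSpace E M] [IsManifold 𝓘(ℝ, E) ∞ M] :=
  CovariantDerivative 𝓘(ℝ, E) E (TangentSpace 𝓘(ℝ, E) : M → Type _)

section Metric

variable {E : Type*} [NormedAddCommGroup E] [NormedSpace ℝ E]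
  {M : Type*} [TopologicalSpace M] [ChartedSpace E M] [IsManifold 𝓘(ℝ, E) ∞ M]

theorem mdiffAt_inner (g : Metric E M) {Y Z : Π x : M, TangentSpace 𝓘(ℝ, E) x} {x : M}
    (hY : MDiffAt (T% Y) x) (hZ : MDiffAt (T% Z) x) :
    MDiffAt (fun y => g.inner y (Y y) (Z y)) x := by
  have h := g.contMDiff.mdifferentiableAt (x := x) (by simp)
  have := MDifferentiableAt.clm_bundle_apply₂ (F₁ := E) (F₂ := E) (F₃ := ℝ)
    (E₃ := Bundle.Trivial M ℝ) h hY hZ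
  simp only [mdifferentiableAt_totalSpace] at this
  exact this.2

theorem inner_injective (g : Metric E M) (x : M) :
    Function.Injective (g.inner x) := by
  intro u v h
  by_contra hne
  have h1 := g.pos x (u - v) (sub_ne_zero.mpr hne)
  have h2 : g.inner x (u - v) = 0 := by rw [map_sub, h, sub_self]
  rw [h2] at h1
  simp at h1

theorem mvfderiv_inner_smul_left (g : Metric E M) {f : M → ℝ}
    {Y Z : Π x : M, TangentSpace 𝓘(ℝ, E) x} {x : M} (hf : MDiffAt f x)
    (hY : MDiffAt (T% Y) x) (hZ : MDiffAt (T% Z) x) (u : TangentSpace 𝓘(ℝ, E) x) :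
    mvfderiv 𝓘(ℝ, E) (fun y => g.inner y ((f • Y) y) (Z y)) x u
      = f x * mvfderiv 𝓘(ℝ, E) (fun y => g.inner y (Y y) (Z y)) x u
        + mvfderiv 𝓘(ℝ, E) f x u * g.inner x (Y x) (Z x) := by
  have h : (fun y => g.inner y ((f • Y) y) (Z y)) = f * (fun y => g.inner y (Y y) (Z y)) := by
    funext y; simp
  rw [h, mvfderiv_mul hf (mdiffAt_inner g hY hZ)]
  simp; ring

theorem mvfderiv_inner_comm (g : Metric E M)
    {Y Z : Π x : M, TangentSpace 𝓘(ℝ, E) x} {x : M} (u : TangentSpace 𝓘(ℝ, E) x) :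
    mvfderiv 𝓘(ℝ, E) (fun y => g.inner y (Y y) (Z y)) x u
      = mvfderiv 𝓘(ℝ, E) (fun y => g.inner y (Z y) (Y y)) x u := by
  have h : (fun y => g.inner y (Y y) (Z y)) = (fun y => g.inner y (Z y) (Y y)) := by
    funext y; exact g.symm y _ _
  rw [h]

theorem mvfderiv_inner_smul_right (g : Metric E M) {f : M → ℝ}
    {Y Z : Π x : M, TangentSpace 𝓘(ℝ, E) x} {x : M} (hf : MDiffAt f x)
    (hY : MDiffAt (T% Y) x) (hZ : MDiffAt (T% Z) x) (u : TangentSpace 𝓘(ℝ, E) x) :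
    mvfderiv 𝓘(ℝ, E) (fun y => g.inner y (Y y) ((f • Z) y)) x u
      = f x * mvfderiv 𝓘(ℝ, E) (fun y => g.inner y (Y y) (Z y)) x u
        + mvfderiv 𝓘(ℝ, E) f x u * g.inner x (Y x) (Z x) := by
  rw [mvfderiv_inner_comm, mvfderiv_inner_smul_left g hf hZ hY, mvfderiv_inner_comm,
    g.symm x (Z x)]

theorem mvfderiv_inner_add_left (g : Metric E M)
    {Y Y' Z : Π x : M, TangentSpace 𝓘(ℝ, E) x} {x : M}
    (hY : MDiffAt (T% Y) x) (hY' : MDiffAt (T% Y') x) (hZ : MDiffAt (T% Z) x)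
    (u : TangentSpace 𝓘(ℝ, E) x) :
    mvfderiv 𝓘(ℝ, E) (fun y => g.inner y ((Y + Y') y) (Z y)) x u
      = mvfderiv 𝓘(ℝ, E) (fun y => g.inner y (Y y) (Z y)) x u
        + mvfderiv 𝓘(ℝ, E) (fun y => g.inner y (Y' y) (Z y)) x u := by
  have h : (fun y => g.inner y ((Y + Y') y) (Z y))
      = (fun y => g.inner y (Y y) (Z y)) + (fun y => g.inner y (Y' y) (Z y)) := by
    funext y; simp
  rw [h, mvfderiv_add (mdiffAt_inner g hY hZ) (mdiffAt_inner g hY' hZ)]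
  rfl

theorem mvfderiv_inner_add_right (g : Metric E M)
    {Y Y' Z : Π x : M, TangentSpace 𝓘(ℝ, E) x} {x : M}
    (hY : MDiffAt (T% Y) x) (hY' : MDiffAt (T% Y') x) (hZ : MDiffAt (T% Z) x)
    (u : TangentSpace 𝓘(ℝ, E) x) :
    mvfderiv 𝓘(ℝ, E) (fun y => g.inner y (Z y) ((Y + Y') y)) x u
      = mvfderiv 𝓘(ℝ, E) (fun y => g.inner y (Z y) (Y y)) x u
        + mvfderiv 𝓘(ℝ, E) (fun y => g.inner y (Z y) (Y' y)) x u := by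
  rw [mvfderiv_inner_comm, mvfderiv_inner_add_left g hY hY' hZ, mvfderiv_inner_comm,
    mvfderiv_inner_comm g (Y := Y')]

end Metric

section LeviCivita

variable {E : Type*} [NormedAddCommGroup E] [NormedSpace ℝ E] [FiniteDimensional ℝ E]
  {M : Type*} [TopologicalSpace M] [ChartedSpace E M] [IsManifold 𝓘(ℝ, E) ∞ M]

/-- The isomorphism `u ↦ g(u, ·)` from `T_x M` to its dual. -/
def flat (g : Metric E M) (x : M) :
    TangentSpace 𝓘(ℝ, E) x ≃ₗ[ℝ] (TangentSpace 𝓘(ℝ, E) x →L[ℝ] ℝ) :=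
  haveI : FiniteDimensional ℝ (TangentSpace 𝓘(ℝ, E) x) := inferInstanceAs (FiniteDimensional ℝ E)
  haveI : FiniteDimensional ℝ (TangentSpace 𝓘(ℝ, E) x →L[ℝ] ℝ) :=
    inferInstanceAs (FiniteDimensional ℝ (E →L[ℝ] ℝ))
  LinearEquiv.ofInjectiveOfFinrankEq (g.inner x).toLinearMap (inner_injective g x)
    (by
      have h : Module.finrank ℝ (E →L[ℝ] ℝ) = Module.finrank ℝ E := by
        rw [← (LinearMap.toContinuousLinearMap (𝕜 := ℝ) (E := E) (F' := ℝ)).finrank_eq]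
        exact Subspace.dual_finrank_eq
      exact h.symm)

theorem flat_symm_inner (g : Metric E M) (x : M) (l : TangentSpace 𝓘(ℝ, E) x →L[ℝ] ℝ)
    (u : TangentSpace 𝓘(ℝ, E) x) : g.inner x ((flat g x).symm l) u = l u := by
  have h := (flat g x).apply_symm_apply l
  exact congrArg (fun k : TangentSpace 𝓘(ℝ, E) x →L[ℝ] ℝ => k u) h

/-- `cov` is a Levi-Civita connection of `g`: it is torsion free and
`u (g(Y, Z)) = g(∇_u Y, Z) + g(Y, ∇_u Z)`. -/
def IsLeviCivita (g : Metric E M) (cov : Connection E M) : Prop :=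
  cov.torsion = 0 ∧
  ∀ (Y Z : Π x : M, TangentSpace 𝓘(ℝ, E) x) (x : M), MDiffAt (T% Y) x → MDiffAt (T% Z) x →
    ∀ u : TangentSpace 𝓘(ℝ, E) x,
      mvfderiv 𝓘(ℝ, E) (fun y => g.inner y (Y y) (Z y)) x u
        = g.inner x (cov Y x u) (Z x) + g.inner x (Y x) (cov Z x u)

/-- The right-hand side of the Koszul formula for `g(∇_X Y, Z)`. -/
def koszul (g : Metric E M) (X Y Z : Π x : M, TangentSpace 𝓘(ℝ, E) x) (x : M) : ℝ :=
  (1 / 2) * (mvfderiv 𝓘(ℝ, E) (fun y => g.inner y (Y y) (Z y)) x (X x)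
    + mvfderiv 𝓘(ℝ, E) (fun y => g.inner y (Z y) (X y)) x (Y x)
    - mvfderiv 𝓘(ℝ, E) (fun y => g.inner y (X y) (Y y)) x (Z x)
    + g.inner x (Z x) (VectorField.mlieBracket 𝓘(ℝ, E) X Y x)
    + g.inner x (Y x) (VectorField.mlieBracket 𝓘(ℝ, E) Z X x)
    - g.inner x (X x) (VectorField.mlieBracket 𝓘(ℝ, E) Y Z x))

section
variable (g : Metric E M) {X X' Y Y' Z Z' : Π x : M, TangentSpace 𝓘(ℝ, E) x} {f : M → ℝ} {x : M}

theorem koszul_smul_left (hf : MDiffAt f x) (hX : MDiffAt (T% X) x) (hY : MDiffAt (T% Y) x)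
    (hZ : MDiffAt (T% Z) x) : koszul g (f • X) Y Z x = f x * koszul g X Y Z x := by
  unfold koszul
  rw [mvfderiv_inner_smul_right g hf hZ hX, mvfderiv_inner_smul_left g hf hX hY,
    VectorField.mlieBracket_smul_left hf hX, VectorField.mlieBracket_smul_right hf hX]
  simp [g.symm x (Y x) (X x), g.symm x (Z x) (X x)]
  ring

theorem koszul_smul_right (hf : MDiffAt f x) (hX : MDiffAt (T% X) x) (hY : MDiffAt (T% Y) x)
    (hZ : MDiffAt (T% Z) x) : koszul g X Y (f • Z) x = f x * koszul g X Y Z x := by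
  unfold koszul
  rw [mvfderiv_inner_smul_right g hf hY hZ, mvfderiv_inner_smul_left g hf hZ hX,
    VectorField.mlieBracket_smul_left hf hZ, VectorField.mlieBracket_smul_right hf hZ]
  simp [g.symm x (Y x) (Z x), g.symm x (Z x) (X x)]
  ring

theorem koszul_smul_middle (hf : MDiffAt f x) (hX : MDiffAt (T% X) x) (hY : MDiffAt (T% Y) x)
    (hZ : MDiffAt (T% Z) x) : koszul g X (f • Y) Z x
      = f x * koszul g X Y Z x + mvfderiv 𝓘(ℝ, E) f x (X x) * g.inner x (Y x) (Z x) := by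
  unfold koszul
  rw [mvfderiv_inner_smul_right g hf hX hY, mvfderiv_inner_smul_left g hf hY hZ,
    VectorField.mlieBracket_smul_left hf hY, VectorField.mlieBracket_smul_right hf hY]
  simp [g.symm x (Z x) (Y x)]
  ring

theorem koszul_add_left (hX : MDiffAt (T% X) x) (hX' : MDiffAt (T% X') x)
    (hY : MDiffAt (T% Y) x) (hZ : MDiffAt (T% Z) x) :
    koszul g (X + X') Y Z x = koszul g X Y Z x + koszul g X' Y Z x := by
  unfold koszul
  rw [mvfderiv_inner_add_right g hX hX' hZ, mvfderiv_inner_add_left g hX hX' hY,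
    VectorField.mlieBracket_add_left hX hX', VectorField.mlieBracket_add_right hX hX']
  simp
  ring

theorem koszul_add_middle (hX : MDiffAt (T% X) x) (hY : MDiffAt (T% Y) x)
    (hY' : MDiffAt (T% Y') x) (hZ : MDiffAt (T% Z) x) :
    koszul g X (Y + Y') Z x = koszul g X Y Z x + koszul g X Y' Z x := by
  unfold koszul
  rw [mvfderiv_inner_add_right g hY hY' hX, mvfderiv_inner_add_left g hY hY' hZ,
    VectorField.mlieBracket_add_left hY hY', VectorField.mlieBracket_add_right hY hY']
  simp
  ring

theorem koszul_add_right (hX : MDiffAt (T% X) x) (hY : MDiffAt (T% Y) x)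
    (hZ : MDiffAt (T% Z) x) (hZ' : MDiffAt (T% Z') x) :
    koszul g X Y (Z + Z') x = koszul g X Y Z x + koszul g X Y Z' x := by
  unfold koszul
  rw [mvfderiv_inner_add_right g hZ hZ' hY, mvfderiv_inner_add_left g hZ hZ' hX,
    VectorField.mlieBracket_add_left hZ hZ', VectorField.mlieBracket_add_right hZ hZ']
  simp
  ring

/-- For fixed `Y`, the Koszul expression as a bilinear form in `X` and `Z` at the point `x`. -/
def koszulForm (hY : MDiffAt (T% Y) x) :
    TangentSpace 𝓘(ℝ, E) x →L[ℝ] TangentSpace 𝓘(ℝ, E) x →L[ℝ] ℝ :=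
  TensorialAt.mkHom₂ (I := 𝓘(ℝ, E)) (F := E) (F' := E) (fun X Z => koszul g X Y Z x) x
    (fun _ hZ => ⟨fun hf hX => koszul_smul_left g hf hX hY hZ,
      fun hX hX' => koszul_add_left g hX hX' hY hZ⟩)
    (fun _ hX => ⟨fun hf hZ => koszul_smul_right g hf hX hY hZ,
      fun hZ hZ' => koszul_add_right g hX hY hZ hZ'⟩)

theorem koszulForm_apply (hX : MDiffAt (T% X) x) (hY : MDiffAt (T% Y) x)
    (hZ : MDiffAt (T% Z) x) : koszulForm g hY (X x) (Z x) = koszul g X Y Z x :=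
  TensorialAt.mkHom₂_apply _ _ hX hZ

open Classical in
/-- The operator defined by the Koszul formula. -/
def koszulCov (Y : Π x : M, TangentSpace 𝓘(ℝ, E) x) (x : M) :
    TangentSpace 𝓘(ℝ, E) x →L[ℝ] TangentSpace 𝓘(ℝ, E) x :=
  haveI : FiniteDimensional ℝ (TangentSpace 𝓘(ℝ, E) x) := inferInstanceAs (FiniteDimensional ℝ E)
  haveI : T2Space (TangentSpace 𝓘(ℝ, E) x) := inferInstanceAs (T2Space E)
  if hY : MDiffAt (T% Y) x then
    LinearMap.toContinuousLinearMap
      ((flat g x).symm.toLinearMap ∘ₗ (koszulForm g hY).toLinearMap)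
  else 0

theorem inner_koszulCov (hX : MDiffAt (T% X) x) (hY : MDiffAt (T% Y) x)
    (hZ : MDiffAt (T% Z) x) :
    g.inner x (koszulCov g Y x (X x)) (Z x) = koszul g X Y Z x := by
  rw [← koszulForm_apply g hX hY hZ]
  unfold koszulCov
  rw [dif_pos hY]
  exact flat_symm_inner g x _ _

theorem koszulCov_eq (hY : MDiffAt (T% Y) x) (u w : TangentSpace 𝓘(ℝ, E) x)
    (h : ∀ Z : Π x : M, TangentSpace 𝓘(ℝ, E) x, MDiffAt (T% Z) x →
      g.inner x w (Z x) = koszul g (FiberBundle.extend E u) Y Z x) :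
    koszulCov g Y x u = w := by
  apply inner_injective g x
  ext v
  have hu : MDiffAt (T% (FiberBundle.extend E u)) x :=
      FiberBundle.mdifferentiableAt_extend ..
  have hv : MDiffAt (T% (FiberBundle.extend E v)) x :=
      FiberBundle.mdifferentiableAt_extend ..
  have h1 := inner_koszulCov g hu hY hv
  have h2 := h _ hv
  simp only [FiberBundle.extend_apply_self] at h1 h2
  rw [h1, h2]

end

/-- The fundamental theorem of Riemannian geometry (existence). -/
theorem exists_isLeviCivita (g : Metric E M) : ∃ cov : Connection E M, IsLeviCivita g cov := by
  refine ⟨⟨koszulCov g, ?_, ?_⟩, ?_, ?_⟩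
  · intro Y Y' x hY hY' _
    ext u
    have hu : MDiffAt (T% (FiberBundle.extend E u)) x :=
      FiberBundle.mdifferentiableAt_extend ..
    refine koszulCov_eq g (mdifferentiableAt_add_section hY hY') u _ fun Z hZ => ?_
    have h1 := inner_koszulCov g hu hY hZ
    have h2 := inner_koszulCov g hu hY' hZ
    simp only [FiberBundle.extend_apply_self] at h1 h2
    rw [koszul_add_middle g hu hY hY' hZ, ← h1, ← h2]
    simp
  · intro Y f x hY hf _
    ext u
    have hu : MDiffAt (T% (FiberBundle.extend E u)) x :=
      FiberBundle.mdifferentiableAt_extend ..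
    refine koszulCov_eq g (hf.smul_section hY) u _ fun Z hZ => ?_
    have h1 := inner_koszulCov g hu hY hZ
    have h2 := koszul_smul_middle g hf hu hY hZ
    simp only [FiberBundle.extend_apply_self] at h1 h2
    rw [h2, ← h1]
    simp
  · rw [CovariantDerivative.torsion_eq_zero_iff]
    intro X Y x hX hY
    apply inner_injective g x
    ext v
    have hv : MDiffAt (T% (FiberBundle.extend E v)) x :=
      FiberBundle.mdifferentiableAt_extend ..
    have h1 := inner_koszulCov g hX hY hv
    have h2 := inner_koszulCov g hY hX hv
    simp only [FiberBundle.extend_apply_self] at h1 h2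
    change g.inner x (koszulCov g Y x (X x) - koszulCov g X x (Y x)) v = _
    rw [map_sub, sub_apply, h1, h2]
    unfold koszul
    rw [VectorField.mlieBracket_swap_apply (V := Y) (W := X),
      VectorField.mlieBracket_swap_apply (V := FiberBundle.extend E v) (W := X),
      VectorField.mlieBracket_swap_apply (V := FiberBundle.extend E v) (W := Y),
      mvfderiv_inner_comm g (Y := Y) (Z := X),
      mvfderiv_inner_comm g (Y := FiberBundle.extend E v) (Z := X),
      mvfderiv_inner_comm g (Y := FiberBundle.extend E v) (Z := Y),
      g.symm x (VectorField.mlieBracket 𝓘(ℝ, E) X Y x) v]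
    simp
    ring
  · intro Y Z x hY hZ u
    have hu : MDiffAt (T% (FiberBundle.extend E u)) x :=
      FiberBundle.mdifferentiableAt_extend ..
    have h1 := inner_koszulCov g hu hY hZ
    have h2 := inner_koszulCov g hu hZ hY
    simp only [FiberBundle.extend_apply_self] at h1 h2
    change _ = g.inner x (koszulCov g Y x u) (Z x) + g.inner x (Y x) (koszulCov g Z x u)
    rw [g.symm x (Y x), h1, h2]
    unfold koszul
    rw [VectorField.mlieBracket_swap_apply (V := Z) (W := Y),
      VectorField.mlieBracket_swap_apply (V := Z) (W := FiberBundle.extend E u),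
      VectorField.mlieBracket_swap_apply (V := Y) (W := FiberBundle.extend E u),
      mvfderiv_inner_comm g (Y := Z) (Z := Y),
      mvfderiv_inner_comm g (Y := Z) (Z := FiberBundle.extend E u),
      mvfderiv_inner_comm g (Y := Y) (Z := FiberBundle.extend E u)]
    simp
    ring

/-- The Levi-Civita connection of `g`. On differentiable vector fields it is unique. -/
def leviCivita (g : Metric E M) : Connection E M := (exists_isLeviCivita g).choose

theorem leviCivita_spec (g : Metric E M) : IsLeviCivita g (leviCivita g) :=
  (exists_isLeviCivita g).choose_spec

end LeviCivita

section Trace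

variable {E : Type*} [NormedAddCommGroup E] [NormedSpace ℝ E] [FiniteDimensional ℝ E]
  {M : Type*} [TopologicalSpace M] [ChartedSpace E M] [IsManifold 𝓘(ℝ, E) ∞ M]

theorem exists_orthonormalBasis (g : Metric E M) (x : M) :
    ∃ b : Module.Basis (Fin (Module.finrank ℝ E)) ℝ (TangentSpace 𝓘(ℝ, E) x),
      ∀ i j, g.inner x (b i) (b j) = if i = j then 1 else 0 := by
  let c : InnerProductSpace.Core ℝ (TangentSpace 𝓘(ℝ, E) x) := g.toRiemannianMetric.toCore x
  let n : NormedAddCommGroup (TangentSpace 𝓘(ℝ, E) x) := c.toNormedAddCommGroup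
  let p : InnerProductSpace ℝ (TangentSpace 𝓘(ℝ, E) x) := .ofCore c.toCore
  have : FiniteDimensional ℝ (TangentSpace 𝓘(ℝ, E) x) := inferInstanceAs (FiniteDimensional ℝ E)
  let b := stdOrthonormalBasis ℝ (TangentSpace 𝓘(ℝ, E) x)
  have h : ∀ i j, inner ℝ (b.toBasis i) (b.toBasis j) = if i = j then (1 : ℝ) else 0 := by
    intro i j
    rw [OrthonormalBasis.coe_toBasis]
    exact (orthonormal_iff_ite.mp b.orthonormal) i j
  exact ⟨b.toBasis, fun i j => h i j⟩

/-- A `g`-orthonormal basis of `T_x M`. -/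
def orthonormalBasis (g : Metric E M) (x : M) :
    Module.Basis (Fin (Module.finrank ℝ E)) ℝ (TangentSpace 𝓘(ℝ, E) x) :=
  (exists_orthonormalBasis g x).choose

theorem orthonormalBasis_spec (g : Metric E M) (x : M) (i j : Fin (Module.finrank ℝ E)) :
    g.inner x (orthonormalBasis g x i) (orthonormalBasis g x j) = if i = j then 1 else 0 :=
  (exists_orthonormalBasis g x).choose_spec i j

/-- The trace `∑ i, B (e i) (e i)` of a bilinear map `B` on `T_x M` over a `g`-orthonormal basis
`e` of `T_x M`. -/
def metricTrace (g : Metric E M) (x : M) {W : Type*} [AddCommMonoid W]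
    (B : TangentSpace 𝓘(ℝ, E) x → TangentSpace 𝓘(ℝ, E) x → W) : W :=
  ∑ i, B (orthonormalBasis g x i) (orthonormalBasis g x i)

/-- The gradient of `α`: `g(grad α, u) = u(α)`. -/
def grad (g : Metric E M) (α : M → ℝ) (x : M) : TangentSpace 𝓘(ℝ, E) x :=
  (flat g x).symm (mvfderiv 𝓘(ℝ, E) α x)

/-- The Laplacian `Tr_g Hess α`, where `Hess α (u, v) = g(∇_u grad α, v)`. -/
def laplacian (g : Metric E M) (α : M → ℝ) (x : M) : ℝ :=
  metricTrace g x fun u v => g.inner x (leviCivita g (grad g α) x u) v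

/-- The curvature `R(X, Y)Z = ∇_X ∇_Y Z - ∇_Y ∇_X Z - ∇_[X, Y] Z` on vector fields. -/
def curvatureField (cov : Connection E M) (X Y Z : Π x : M, TangentSpace 𝓘(ℝ, E) x) (x : M) :
    TangentSpace 𝓘(ℝ, E) x :=
  cov (fun y => cov Z y (Y y)) x (X x) - cov (fun y => cov Z y (X y)) x (Y x)
    - cov Z x (VectorField.mlieBracket 𝓘(ℝ, E) X Y x)

/-- The curvature tensor `R(u, v)w` at `x`, computed with vector fields, smooth near `x`, that
extend `u`, `v`, `w`. -/
def curvature (cov : Connection E M) (x : M) (u v w : TangentSpace 𝓘(ℝ, E) x) :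
    TangentSpace 𝓘(ℝ, E) x :=
  curvatureField cov (FiberBundle.extend E u) (FiberBundle.extend E v) (FiberBundle.extend E w) x

/-- The Ricci tensor as an endomorphism: `Ricci u = ∑ i, R(u, e i) (e i)`. -/
def ricci (g : Metric E M) (x : M) (u : TangentSpace 𝓘(ℝ, E) x) : TangentSpace 𝓘(ℝ, E) x :=
  metricTrace g x fun v w => curvature (leviCivita g) x u v w

/-- `-Tr_g (∇ ∇ - ∇_∇) W` for a vector field `W` on `M`. -/
def roughLaplacian (g : Metric E M) (W : Π x : M, TangentSpace 𝓘(ℝ, E) x) (x : M) :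
    TangentSpace 𝓘(ℝ, E) x :=
  - metricTrace g x fun u v =>
    leviCivita g (fun y => leviCivita g W y (FiberBundle.extend E v y)) x u
      - leviCivita g W x (leviCivita g (FiberBundle.extend E v) x u)

end Trace

section Maps

variable {E : Type*} [NormedAddCommGroup E] [NormedSpace ℝ E] [FiniteDimensional ℝ E]
  {M : Type*} [TopologicalSpace M] [ChartedSpace E M] [IsManifold 𝓘(ℝ, E) ∞ M]
  {E' : Type*} [NormedAddCommGroup E'] [NormedSpace ℝ E'] [FiniteDimensional ℝ E']
  {N : Type*} [TopologicalSpace N] [ChartedSpace E' N] [IsManifold 𝓘(ℝ, E') ∞ N]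

/-- The pull-back connection `∇^φ` on `φ⁻¹ TN`, evaluated on a section `W` along `φ`:
in the trivialization of `TN` around `φ x`, it is the derivative of the coordinates of `W` plus
the covariant derivative in the direction `dφ` of the local vector field on `N` with constant
coordinates that takes the value `W x` at `φ x`. -/
def pullbackCov (cov : Connection E' N) (φ : M → N) (W : Π x : M, TangentSpace 𝓘(ℝ, E') (φ x))
    (x : M) : TangentSpace 𝓘(ℝ, E) x →L[ℝ] TangentSpace 𝓘(ℝ, E') (φ x) :=
  ((trivializationAt E' (TangentSpace 𝓘(ℝ, E') : N → Type _) (φ x)).symmL ℝ (φ x)).comp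
      (mvfderiv 𝓘(ℝ, E) (fun y : M =>
        (trivializationAt E' (TangentSpace 𝓘(ℝ, E') : N → Type _) (φ x) ⟨φ y, W y⟩).2) x)
    + (cov (FiberBundle.extend E' (W x)) (φ x)).comp (mfderiv 𝓘(ℝ, E) 𝓘(ℝ, E') φ x)

/-- The tension field `τ(φ) = Tr_g ∇dφ` of `φ : (M, g) → (N, h)`. -/
def tension (g : Metric E M) (h : Metric E' N) (φ : M → N) (x : M) :
    TangentSpace 𝓘(ℝ, E') (φ x) :=
  metricTrace g x fun u v =>
    pullbackCov (leviCivita h) φ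
        (fun y => mfderiv 𝓘(ℝ, E) 𝓘(ℝ, E') φ y (FiberBundle.extend E v y)) x u
      - mfderiv 𝓘(ℝ, E) 𝓘(ℝ, E') φ x (leviCivita g (FiberBundle.extend E v) x u)

/-- The rough Laplacian `Δ^φ W = -Tr_g (∇^φ ∇^φ - ∇^φ_∇) W` of a section `W` of `φ⁻¹ TN`. -/
def roughLaplacianAlong (g : Metric E M) (h : Metric E' N) (φ : M → N)
    (W : Π x : M, TangentSpace 𝓘(ℝ, E') (φ x)) (x : M) : TangentSpace 𝓘(ℝ, E') (φ x) :=
  - metricTrace g x fun u v =>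
    pullbackCov (leviCivita h) φ
        (fun y => pullbackCov (leviCivita h) φ W y (FiberBundle.extend E v y)) x u
      - pullbackCov (leviCivita h) φ W x (leviCivita g (FiberBundle.extend E v) x u)

/-- The bitension field `τ₂(φ) = Δ^φ τ(φ) - Tr_g R^N(τ(φ), dφ) dφ`. -/
def bitension (g : Metric E M) (h : Metric E' N) (φ : M → N) (x : M) :
    TangentSpace 𝓘(ℝ, E') (φ x) :=
  roughLaplacianAlong g h φ (tension g h φ) x
    - metricTrace g x fun u v => curvature (leviCivita h) (φ x) (tension g h φ x)
        (mfderiv 𝓘(ℝ, E) 𝓘(ℝ, E') φ x u) (mfderiv 𝓘(ℝ, E) 𝓘(ℝ, E') φ x v)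

/-- A smooth map is harmonic if its tension field vanishes. -/
def IsHarmonic (g : Metric E M) (h : Metric E' N) (φ : M → N) : Prop :=
  ContMDiff 𝓘(ℝ, E) 𝓘(ℝ, E') ∞ φ ∧ ∀ x, tension g h φ x = 0

/-- A smooth map is biharmonic if its bitension field vanishes. -/
def IsBiharmonic (g : Metric E M) (h : Metric E' N) (φ : M → N) : Prop :=
  ContMDiff 𝓘(ℝ, E) 𝓘(ℝ, E') ∞ φ ∧ ∀ x, bitension g h φ x = 0

/-- A proper biharmonic map is a biharmonic map that is not harmonic. -/
def IsProperBiharmonic (g : Metric E M) (h : Metric E' N) (φ : M → N) : Prop :=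
  IsBiharmonic g h φ ∧ ¬ IsHarmonic g h φ

end Maps

section Berger

variable {E : Type*} [NormedAddCommGroup E] [NormedSpace ℝ E]
  {M : Type*} [TopologicalSpace M] [ChartedSpace E M] [IsManifold 𝓘(ℝ, E) ∞ M]

/-- A smooth vector field on `M`. -/
def SmoothField (X : Π x : M, TangentSpace 𝓘(ℝ, E) x) : Prop :=
  ContMDiff 𝓘(ℝ, E) (𝓘(ℝ, E).prod 𝓘(ℝ, E)) ∞
    (fun x => (Bundle.TotalSpace.mk' E x (X x) : TangentBundle 𝓘(ℝ, E) M))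

/-- A smooth `(1,1)` tensor field on `M`. -/
def SmoothEndo (F : Π x : M, TangentSpace 𝓘(ℝ, E) x →L[ℝ] TangentSpace 𝓘(ℝ, E) x) : Prop :=
  ContMDiff 𝓘(ℝ, E) (𝓘(ℝ, E).prod 𝓘(ℝ, E →L[ℝ] E)) ∞
    (fun x => Bundle.TotalSpace.mk' (E →L[ℝ] E)
      (E := fun x : M => TangentSpace 𝓘(ℝ, E) x →L[ℝ] TangentSpace 𝓘(ℝ, E) x) x (F x))

theorem SmoothEndo.apply {F : Π x : M, TangentSpace 𝓘(ℝ, E) x →L[ℝ] TangentSpace 𝓘(ℝ, E) x}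
    {X : Π x : M, TangentSpace 𝓘(ℝ, E) x} (hF : SmoothEndo F) (hX : SmoothField X) :
    SmoothField (fun x => F x (X x)) :=
  ContMDiff.clm_bundle_apply (F₁ := E) (F₂ := E) hF hX

/-- The tensor `g(·, ξ) ⊗ g(·, ξ)`. -/
def sqForm (g : Metric E M) (ξ : Π x : M, TangentSpace 𝓘(ℝ, E) x) (x : M) :
    TangentSpace 𝓘(ℝ, E) x →L[ℝ] TangentSpace 𝓘(ℝ, E) x →L[ℝ] ℝ :=
  (g.inner x (ξ x)).smulRight (g.inner x (ξ x))

theorem contMDiff_sqForm (g : Metric E M) {ξ : Π x : M, TangentSpace 𝓘(ℝ, E) x}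
    (hξ : SmoothField ξ) :
    ContMDiff 𝓘(ℝ, E) (𝓘(ℝ, E).prod 𝓘(ℝ, E →L[ℝ] E →L[ℝ] ℝ)) ∞
      (fun x => Bundle.TotalSpace.mk' (E →L[ℝ] E →L[ℝ] ℝ)
        (E := fun x : M => TangentSpace 𝓘(ℝ, E) x →L[ℝ] TangentSpace 𝓘(ℝ, E) x →L[ℝ] ℝ)
        x (sqForm g ξ x)) := by
  have h1 := ContMDiff.clm_bundle_apply (F₁ := E) (F₂ := E →L[ℝ] ℝ) g.contMDiff hξ
  intro x₀
  have h2 := (contMDiffAt_hom_bundle (F₁ := E) (F₂ := ℝ) _).mp (h1 x₀)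
  refine (contMDiffAt_hom_bundle (F₁ := E) (F₂ := E →L[ℝ] ℝ) _).mpr ⟨contMDiffAt_id, ?_⟩
  have h3 := h2.2
  have h4 : ContMDiffAt 𝓘(ℝ, E) 𝓘(ℝ, E →L[ℝ] E →L[ℝ] ℝ) ∞
      (fun x => ContinuousLinearMap.smulRightL ℝ E (E →L[ℝ] ℝ)
        (ContinuousLinearMap.inCoordinates E (TangentSpace 𝓘(ℝ, E) : M → Type _) ℝ
          (Bundle.Trivial M ℝ) x₀ x x₀ x (g.inner x (ξ x)))
        (ContinuousLinearMap.inCoordinates E (TangentSpace 𝓘(ℝ, E) : M → Type _) ℝ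
          (Bundle.Trivial M ℝ) x₀ x x₀ x (g.inner x (ξ x)))) x₀ :=
    (contMDiffAt_const.clm_apply h3).clm_apply h3
  refine h4.congr_of_eventuallyEq ?_
  filter_upwards [(trivializationAt E (TangentSpace 𝓘(ℝ, E) : M → Type _) x₀).open_baseSet.mem_nhds
    (FiberBundle.mem_baseSet_trivializationAt' x₀)] with x hx
  ext v w
  rw [inCoordinates_apply_eq₂ hx hx (by simp)]
  have hs : ∀ z : E, (trivializationAt E (TangentSpace 𝓘(ℝ, E) : M → Type _) x₀).symmL ℝ x z
      = (trivializationAt E (TangentSpace 𝓘(ℝ, E) : M → Type _) x₀).symm x z :=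
    fun z => Bundle.Trivialization.symmL_apply _ hx z
  simp [sqForm, ContinuousLinearMap.inCoordinates]
  erw [hs v, hs w]

theorem sqForm_apply (g : Metric E M) (ξ : Π x : M, TangentSpace 𝓘(ℝ, E) x) (x : M)
    (u v : TangentSpace 𝓘(ℝ, E) x) :
    sqForm g ξ x u v = g.inner x u (ξ x) * g.inner x v (ξ x) := by
  simp [sqForm, g.symm x (ξ x)]

/-- The deformed metric `g^α(u, v) = α (g(u, v) + g(u, F V) g(v, F V))`. -/
def bergerMetric (g : Metric E M)
    (F : Π x : M, TangentSpace 𝓘(ℝ, E) x →L[ℝ] TangentSpace 𝓘(ℝ, E) x)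
    (V : Π x : M, TangentSpace 𝓘(ℝ, E) x) (α : M → ℝ)
    (hF : SmoothEndo F) (hV : SmoothField V) (hα : ContMDiff 𝓘(ℝ, E) 𝓘(ℝ) ∞ α)
    (hpos : ∀ x, 0 < α x) : Metric E M where
  inner x := α x • (g.inner x + sqForm g (fun y => F y (V y)) x)
  symm x u v := by
    simp only [smul_apply, add_apply, sqForm_apply]
    rw [g.symm x u v, mul_comm (g.inner x u _)]
  pos x u hu := by
    simp only [smul_apply, add_apply, sqForm_apply, smul_eq_mul]
    have := g.pos x u hu
    have := hpos x
    have := mul_self_nonneg (g.inner x u (F x (V x)))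
    positivity
  isVonNBounded x := by
    have hs : 0 < Real.sqrt (α x) := Real.sqrt_pos.mpr (hpos x)
    have h := (g.isVonNBounded x).image
      ((Real.sqrt (α x))⁻¹ • ContinuousLinearMap.id ℝ (TangentSpace 𝓘(ℝ, E) x))
    refine h.subset ?_
    intro u hu
    refine ⟨Real.sqrt (α x) • u, ?_, ?_⟩
    · simp only [Set.mem_ofPred_eq, smul_apply, add_apply, sqForm_apply,
        smul_eq_mul] at hu
      have h1 : g.inner x (Real.sqrt (α x) • u) (Real.sqrt (α x) • u)
          = α x * g.inner x u u := by
        simp [← mul_assoc, Real.mul_self_sqrt (hpos x).le]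
      rw [Set.mem_ofPred_eq, h1]
      have := mul_self_nonneg (g.inner x u (F x (V x)))
      nlinarith [hpos x, mul_nonneg (hpos x).le this]
    · simp [smul_smul, hs.ne']
  contMDiff := by
    exact hα.smul_section (g.contMDiff.add_section (contMDiff_sqForm g (hF.apply hV)))

theorem bergerMetric_inner (g : Metric E M)
    (F : Π x : M, TangentSpace 𝓘(ℝ, E) x →L[ℝ] TangentSpace 𝓘(ℝ, E) x)
    (V : Π x : M, TangentSpace 𝓘(ℝ, E) x) (α : M → ℝ)
    (hF : SmoothEndo F) (hV : SmoothField V) (hα : ContMDiff 𝓘(ℝ, E) 𝓘(ℝ) ∞ α)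
    (hpos : ∀ x, 0 < α x) (x : M) (u v : TangentSpace 𝓘(ℝ, E) x) :
    (bergerMetric g F V α hF hV hα hpos).inner x u v
      = α x * (g.inner x u v + g.inner x u (F x (V x)) * g.inner x v (F x (V x))) := by
  change (α x • (g.inner x + sqForm g (fun y => F y (V y)) x)) u v = _
  simp only [smul_apply, add_apply, sqForm_apply, smul_eq_mul]

end Berger

section ParaKahlerNorden

variable {E : Type*} [NormedAddCommGroup E] [NormedSpace ℝ E] [FiniteDimensional ℝ E]
  {M : Type*} [TopologicalSpace M] [ChartedSpace E M] [IsManifold 𝓘(ℝ, E) ∞ M]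

/-- `(M, F, g)` is a para-Kähler-Norden manifold: `F` is an almost para-complex structure
(`F² = id`, and the eigenbundles of `F` for `1` and `-1` have the same rank), `g` is pure with
respect to `F`, and `∇F = 0` for the Levi-Civita connection of `g`. -/
structure IsParaKahlerNorden (g : Metric E M)
    (F : Π x : M, TangentSpace 𝓘(ℝ, E) x →L[ℝ] TangentSpace 𝓘(ℝ, E) x) : Prop where
  smooth : SmoothEndo F
  involutive : ∀ (x : M) (u : TangentSpace 𝓘(ℝ, E) x), F x (F x u) = u
  rank_eq : ∀ x : M,
    Module.finrank ℝ (Module.End.eigenspace (F x).toLinearMap (1 : ℝ))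
      = Module.finrank ℝ (Module.End.eigenspace (F x).toLinearMap (-1 : ℝ))
  pure : ∀ (x : M) (u v : TangentSpace 𝓘(ℝ, E) x), g.inner x (F x u) v = g.inner x u (F x v)
  parallel : ∀ (Y : Π x : M, TangentSpace 𝓘(ℝ, E) x) (x : M), MDiffAt (T% Y) x →
    ∀ u : TangentSpace 𝓘(ℝ, E) x,
      leviCivita g (fun y => F y (Y y)) x u = F x (leviCivita g Y x u)

/-- The vector field
`Δ grad α - Ricci(grad α) - (m - 5)/α ∇_{grad α} grad α
  + 2 ((m - 4) |grad α|² / α² + Δα / α) grad α - (1/2) ∇_{FV} ∇_{FV} grad α`,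
all of whose terms are taken with respect to `g`; the first `Δ` is `-Tr_g (∇ ∇ - ∇_∇)`, and
`Δα = Tr_g Hess α`. -/
def bracketField (m : ℕ) (g : Metric E M)
    (F : Π x : M, TangentSpace 𝓘(ℝ, E) x →L[ℝ] TangentSpace 𝓘(ℝ, E) x)
    (V : Π x : M, TangentSpace 𝓘(ℝ, E) x) (α : M → ℝ) (x : M) : TangentSpace 𝓘(ℝ, E) x :=
  roughLaplacian g (grad g α) x
    - ricci g x (grad g α x)
    - (((m : ℝ) - 5) / α x) • leviCivita g (grad g α) x (grad g α x)
    + (2 * (((m : ℝ) - 4) * g.inner x (grad g α x) (grad g α x) / α x ^ 2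
        + laplacian g α x / α x)) • grad g α x
    - (1 / 2 : ℝ) • leviCivita g (fun y => leviCivita g (grad g α) y (F y (V y))) x (F x (V x))

end ParaKahlerNorden

end RiemannianMaps

end

open RiemannianMaps

/-! Put `ξ = FV`. As `F` is `g`-symmetric, parallel and of square one, `ξ` is a `g`-parallel unit
field. The para-Kähler-Norden structure enters in no other way: `IsParallelDeformation` retains only
`g' = α h` with `h = g + ξ♭ ⊗ ξ♭` and `ξ(α) = 0`.

For the identity map the tension field is the `g'`-trace of `∇ - ∇'` (`tension_id`). Since `∇h = 0`,
the metrics `h` and `g` share their Levi-Civita connection, so `∇ - ∇'` is given by the formula for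
the conformal change `α h` (`leviCivita_sub`); the gradients of `α` for `h` and `g` agree because
`grad α ⊥ ξ`. Moreover `h` doubles `g` along `ξ` and equals it on the complement, so a `g'`-trace is
`1/α` times the `g`-trace minus half the value at `(ξ, ξ)` (`metricTrace_eq`). This yields `τ = (m -
1) α⁻² grad α` (`tension_id_eq`).

The bitension field is `-Tr' ∇²τ - ∇_τ τ - Tr' R(τ, ·)·` (`bitension_id`). Both `(ξ, ξ)` corrections
vanish: `R(·, ·)ξ = 0` since `ξ` is parallel, and `∇_ξ grad α = 0` by symmetry of the Hessian
(`leviCivita_grad_field`). The latter also kills the last term of `B`. What remains is the product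
rule for `(m - 1) α⁻² grad α`. The two equivalences follow since the scalar factors of `τ` and `τ₂`
vanish only for `m = 1`, and `grad α = 0` means `α` constant on a connected manifold.

The groundwork is to show that `∇_X Y` and `grad α` are smooth and that `∇²` and `R`, evaluated
through local extensions of vectors, are tensors. Second derivatives occur, so `SmoothTensorialAt`
demands linearity only for smooth data. -/

noncomputable section

namespace RiemannianMaps

open Topology

/-! ### Vector fields smooth at a point -/

section Smoothness

variable {E : Type*} [NormedAddCommGroup E] [NormedSpace ℝ E]
  {M : Type*} [TopologicalSpace M] [ChartedSpace E M] [IsManifold 𝓘(ℝ, E) ∞ M]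

/-- The vector field `X` is smooth at the point `x`. -/
abbrev SmoothFieldAt (X : Π x : M, TangentSpace 𝓘(ℝ, E) x) (x : M) : Prop :=
  ContMDiffAt 𝓘(ℝ, E) (𝓘(ℝ, E).prod 𝓘(ℝ, E)) ∞
    (fun y => (Bundle.TotalSpace.mk' E y (X y) : TangentBundle 𝓘(ℝ, E) M)) x

theorem SmoothField.smoothFieldAt {X : Π x : M, TangentSpace 𝓘(ℝ, E) x} (hX : SmoothField X)
    (x : M) : SmoothFieldAt X x := hX x

variable {X Y Z : Π x : M, TangentSpace 𝓘(ℝ, E) x} {f : M → ℝ} {x : M}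

theorem SmoothFieldAt.mdifferentiableAt (hX : SmoothFieldAt X x) : MDiffAt (T% X) x :=
  ContMDiffAt.mdifferentiableAt hX (by simp)

theorem SmoothFieldAt.eventually_mdifferentiableAt (hX : SmoothFieldAt X x) :
    ∀ᶠ y in 𝓝 x, MDiffAt (T% X) y := by
  have : IsManifold 𝓘(ℝ, E) 1 M := IsManifold.of_le (n := ∞) (by simp)
  -- Smoothness at a point gives `C^n` on a neighbourhood for each finite `n`, with no neighbourhood
  -- common to all `n`; order one is enough here.
  have h1 : ContMDiffAt 𝓘(ℝ, E) (𝓘(ℝ, E).prod 𝓘(ℝ, E)) 1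
    (fun y => (Bundle.TotalSpace.mk' E y (X y) : TangentBundle 𝓘(ℝ, E) M)) x := hX.of_le (by simp)
  filter_upwards [(contMDiffAt_iff_contMDiffAt_nhds (by simp)).mp h1] with y hy
  exact hy.mdifferentiableAt (by simp)

theorem eventually_mdifferentiableAt_of_contMDiffAt (hf : ContMDiffAt 𝓘(ℝ, E) 𝓘(ℝ) ∞ f x) :
    ∀ᶠ y in 𝓝 x, MDiffAt f y := by
  have : IsManifold 𝓘(ℝ, E) 1 M := IsManifold.of_le (n := ∞) (by simp)
  have h1 : ContMDiffAt 𝓘(ℝ, E) 𝓘(ℝ) 1 f x := hf.of_le (by simp)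
  filter_upwards [(contMDiffAt_iff_contMDiffAt_nhds (by simp)).mp h1] with y hy
  exact hy.mdifferentiableAt (by simp)

theorem SmoothFieldAt.add (hX : SmoothFieldAt X x) (hY : SmoothFieldAt Y x) :
    SmoothFieldAt (X + Y) x :=
  ContMDiffAt.add_section hX hY

theorem SmoothFieldAt.sub (hX : SmoothFieldAt X x) (hY : SmoothFieldAt Y x) :
    SmoothFieldAt (X - Y) x :=
  ContMDiffAt.sub_section hX hY

theorem SmoothFieldAt.smul (hf : ContMDiffAt 𝓘(ℝ, E) 𝓘(ℝ) ∞ f x) (hX : SmoothFieldAt X x) :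
    SmoothFieldAt (f • X) x :=
  ContMDiffAt.smul_section hf hX

theorem smoothFieldAt_extend (u : TangentSpace 𝓘(ℝ, E) x) :
    SmoothFieldAt (FiberBundle.extend E u) x :=
  FiberBundle.contMDiffAt_extend ..

theorem mdifferentiableAt_extend_tangent (u : TangentSpace 𝓘(ℝ, E) x) :
    MDiffAt (T% (FiberBundle.extend E u)) x :=
  FiberBundle.mdifferentiableAt_extend ..

theorem contMDiffAt_inner (g : Metric E M) (hY : SmoothFieldAt Y x) (hZ : SmoothFieldAt Z x) :
    ContMDiffAt 𝓘(ℝ, E) 𝓘(ℝ) ∞ (fun y => g.inner y (Y y) (Z y)) x := by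
  have := ContMDiffAt.clm_bundle_apply₂ (F₁ := E) (F₂ := E) (F₃ := ℝ)
    (E₃ := Bundle.Trivial M ℝ) (g.contMDiff x) hY hZ
  simp only [Bundle.contMDiffAt_totalSpace] at this
  exact this.2

end Smoothness

/-! ### Lie brackets and derivatives of functions -/

section Bracket

variable {E : Type*} [NormedAddCommGroup E] [NormedSpace ℝ E] [FiniteDimensional ℝ E]
  {M : Type*} [TopologicalSpace M] [ChartedSpace E M] [IsManifold 𝓘(ℝ, E) ∞ M]
  {X Y Z : Π x : M, TangentSpace 𝓘(ℝ, E) x} {f : M → ℝ} {x : M}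

theorem SmoothFieldAt.mlieBracket (hX : SmoothFieldAt X x) (hY : SmoothFieldAt Y x) :
    SmoothFieldAt (VectorField.mlieBracket 𝓘(ℝ, E) X Y) x := by
  have : IsManifold 𝓘(ℝ, E) (minSmoothness ℝ 2) M := by
    simp only [minSmoothness_of_isRCLikeNormedField]
    exact IsManifold.of_le (n := ∞) ENat.LEInfty.out
  have : IsManifold 𝓘(ℝ, E) (((⊤ : ℕ∞) : ℕ∞ω) + 1) M := by simpa using ‹IsManifold 𝓘(ℝ, E) ∞ M›
  exact ContMDiffAt.mlieBracket_vectorField (n := ⊤) (m := ⊤) hX hY (by simp)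

/-- The derivative of a smooth function along a smooth vector field is smooth. -/
theorem contMDiffAt_mvfderiv_apply (hf : ContMDiffAt 𝓘(ℝ, E) 𝓘(ℝ) ∞ f x)
    (hX : SmoothFieldAt X x) :
    ContMDiffAt 𝓘(ℝ, E) 𝓘(ℝ) ∞ (fun y => mvfderiv 𝓘(ℝ, E) f y (X y)) x := by
  rcases subsingleton_or_nontrivial E with hE | hE
  · have : (fun y => mvfderiv 𝓘(ℝ, E) f y (X y)) = fun _ => (0 : ℝ) := by
      funext y
      have : X y = 0 := Subsingleton.elim (α := E) _ _
      rw [this, map_zero]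
    rw [this]
    exact contMDiffAt_const
  · let t := trivializationAt E (TangentSpace 𝓘(ℝ, E) : M → Type _) x
    have hx : x ∈ t.baseSet :=
      FiberBundle.mem_baseSet_trivializationAt E (TangentSpace 𝓘(ℝ, E) : M → Type _) x
    let b := Module.finBasis ℝ E
    obtain ⟨i⟩ : Nonempty (Fin (Module.finrank ℝ E)) := ⟨⟨0, Module.finrank_pos⟩⟩
    let Z := t.localFrame b i
    have hZ : SmoothFieldAt Z x := contMDiffAt_localFrame_of_mem ∞ t b i hx
    -- The field `[X, fZ] - f[X, Z] = (Xf) Z` is smooth because brackets are, and its coefficient on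
    -- the frame vector `Z` is `Xf`.
    have hW := (hX.mlieBracket (SmoothFieldAt.smul hf hZ)).sub
      (SmoothFieldAt.smul hf (hX.mlieBracket hZ))
    have hc := contMDiffAt_localFrameCoeff b hx hW i
    refine hc.congr_of_eventuallyEq ?_
    filter_upwards [eventually_mdifferentiableAt_of_contMDiffAt hf,
      hZ.eventually_mdifferentiableAt, t.open_baseSet.mem_nhds hx] with y hfy hZy hy
    have : (VectorField.mlieBracket 𝓘(ℝ, E) X (f • Z) - f • VectorField.mlieBracket 𝓘(ℝ, E) X Z) y
        = mvfderiv 𝓘(ℝ, E) f y (X y) • Z y := by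
      simp [VectorField.mlieBracket_smul_right hfy hZy]
    rw [LinearMap.piApply_apply]
    beta_reduce
    rw [this, map_smul,
      t.localFrameCoeff_apply_of_mem_baseSet b hy Z]
    simp [Z, hy]

/-- The Lie bracket of vector fields acts on functions as the commutator. -/
theorem mvfderiv_mlieBracket (hf : ContMDiffAt 𝓘(ℝ, E) 𝓘(ℝ) ∞ f x)
    (hX : SmoothFieldAt X x) (hY : SmoothFieldAt Y x) :
    mvfderiv 𝓘(ℝ, E) f x (VectorField.mlieBracket 𝓘(ℝ, E) X Y x)
      = mvfderiv 𝓘(ℝ, E) (fun y => mvfderiv 𝓘(ℝ, E) f y (Y y)) x (X x)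
        - mvfderiv 𝓘(ℝ, E) (fun y => mvfderiv 𝓘(ℝ, E) f y (X y)) x (Y x) := by
  rcases subsingleton_or_nontrivial E with hE | hE
  · have h : ∀ u : TangentSpace 𝓘(ℝ, E) x, u = 0 := fun u => Subsingleton.elim (α := E) _ _
    rw [h (VectorField.mlieBracket 𝓘(ℝ, E) X Y x), h (X x), h (Y x)]
    simp
  obtain ⟨z, hz⟩ := exists_ne (0 : E)
  let Z : Π y : M, TangentSpace 𝓘(ℝ, E) y := FiberBundle.extend E (x := x) z
  have hZ : SmoothFieldAt Z x := smoothFieldAt_extend _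
  have hZx : Z x = z := FiberBundle.extend_apply_self ..
  -- The Jacobi identity for `X, Y, fZ`, minus `f` times that for `X, Y, Z`, leaves `(XYf - YXf -
  -- [X,Y]f) Z = 0`: the terms with one derivative of `f` are symmetric in `X` and `Y`. As `Z` does
  -- not vanish at `x`, the coefficient does.
  have key : ∀ {X Y : Π y : M, TangentSpace 𝓘(ℝ, E) y}, SmoothFieldAt X x → SmoothFieldAt Y x →
      VectorField.mlieBracket 𝓘(ℝ, E) X (VectorField.mlieBracket 𝓘(ℝ, E) Y (f • Z)) x
      = mvfderiv 𝓘(ℝ, E) (fun y => mvfderiv 𝓘(ℝ, E) f y (Y y)) x (X x) • Z x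
        + mvfderiv 𝓘(ℝ, E) f x (Y x) • VectorField.mlieBracket 𝓘(ℝ, E) X Z x
        + (mvfderiv 𝓘(ℝ, E) f x (X x) • VectorField.mlieBracket 𝓘(ℝ, E) Y Z x
        + f x • VectorField.mlieBracket 𝓘(ℝ, E) X (VectorField.mlieBracket 𝓘(ℝ, E) Y Z) x) := by
    intro X Y hX hY
    have h1 : VectorField.mlieBracket 𝓘(ℝ, E) Y (f • Z) =ᶠ[𝓝 x]
        (fun y => mvfderiv 𝓘(ℝ, E) f y (Y y)) • Z + f • VectorField.mlieBracket 𝓘(ℝ, E) Y Z := by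
      filter_upwards [eventually_mdifferentiableAt_of_contMDiffAt hf,
        hZ.eventually_mdifferentiableAt] with y hfy hZy
      exact VectorField.mlieBracket_smul_right hfy hZy
    have hYf := contMDiffAt_mvfderiv_apply hf hY
    rw [Filter.EventuallyEq.mlieBracket_vectorField_eq (Filter.EventuallyEq.refl _ X) h1,
      VectorField.mlieBracket_add_right (SmoothFieldAt.smul hYf hZ).mdifferentiableAt
        (SmoothFieldAt.smul hf (hY.mlieBracket hZ)).mdifferentiableAt,
      VectorField.mlieBracket_smul_right (hYf.mdifferentiableAt (by simp)) hZ.mdifferentiableAt,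
      VectorField.mlieBracket_smul_right (hf.mdifferentiableAt (by simp))
        (hY.mlieBracket hZ).mdifferentiableAt]
  have : IsManifold 𝓘(ℝ, E) (minSmoothness ℝ 3) M := by
    simp only [minSmoothness_of_isRCLikeNormedField]
    exact IsManifold.of_le (n := ∞) ENat.LEInfty.out
  have two : ∀ {X : Π y : M, TangentSpace 𝓘(ℝ, E) y}, SmoothFieldAt X x →
      ContMDiffAt 𝓘(ℝ, E) (𝓘(ℝ, E).prod 𝓘(ℝ, E)) (minSmoothness ℝ 2)
        (fun y => (Bundle.TotalSpace.mk' E y (X y) : TangentBundle 𝓘(ℝ, E) M)) x := by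
    intro X hX
    simp only [minSmoothness_of_isRCLikeNormedField]
    exact hX.of_le ENat.LEInfty.out
  have j1 := VectorField.leibniz_identity_mlieBracket_apply (two hX) (two hY)
    (two (SmoothFieldAt.smul hf hZ))
  have j2 := VectorField.leibniz_identity_mlieBracket_apply (two hX) (two hY) (two hZ)
  rw [key hX hY, key hY hX, j2, VectorField.mlieBracket_smul_right (hf.mdifferentiableAt (by simp))
    hZ.mdifferentiableAt] at j1
  have j3 : (mvfderiv 𝓘(ℝ, E) (fun y => mvfderiv 𝓘(ℝ, E) f y (Y y)) x (X x)
        - mvfderiv 𝓘(ℝ, E) (fun y => mvfderiv 𝓘(ℝ, E) f y (X y)) x (Y x)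
        - mvfderiv 𝓘(ℝ, E) f x (VectorField.mlieBracket 𝓘(ℝ, E) X Y x)) • Z x = 0 := by
    have := sub_eq_zero.mpr j1
    rw [← this]
    module
  rw [hZx] at j3
  have := (smul_eq_zero.mp j3).resolve_right hz
  linarith

end Bracket

/-! ### Smoothness tested by inner products; tensoriality for smooth fields -/

section Frames

variable {E : Type*} [NormedAddCommGroup E] [NormedSpace ℝ E] [FiniteDimensional ℝ E]
  {M : Type*} [TopologicalSpace M] [ChartedSpace E M] [IsManifold 𝓘(ℝ, E) ∞ M]
  {X Y Z W : Π x : M, TangentSpace 𝓘(ℝ, E) x} {f : M → ℝ} {x : M}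

theorem contMDiffAt_det {ι : Type*} [Fintype ι] [DecidableEq ι] {A : M → Matrix ι ι ℝ}
    (h : ∀ i j, ContMDiffAt 𝓘(ℝ, E) 𝓘(ℝ) ∞ (fun y => A y i j) x) :
    ContMDiffAt 𝓘(ℝ, E) 𝓘(ℝ) ∞ (fun y => (A y).det) x := by
  simp only [Matrix.det_apply']
  exact contMDiffAt_finsetSum fun σ _ =>
    contMDiffAt_const.mul (contMDiffAt_finsetProd fun i _ => h _ _)

/-- A vector field is smooth if its products with smooth vector fields are. -/
theorem smoothFieldAt_of_inner (g : Metric E M)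
    (h : ∀ Z : Π x : M, TangentSpace 𝓘(ℝ, E) x, SmoothFieldAt Z x →
      ContMDiffAt 𝓘(ℝ, E) 𝓘(ℝ) ∞ (fun y => g.inner y (W y) (Z y)) x) :
    SmoothFieldAt W x := by
  let t := trivializationAt E (TangentSpace 𝓘(ℝ, E) : M → Type _) x
  have hx : x ∈ t.baseSet :=
    FiberBundle.mem_baseSet_trivializationAt E (TangentSpace 𝓘(ℝ, E) : M → Type _) x
  let b := Module.finBasis ℝ E
  let s := t.localFrame b
  have hs : ∀ i, SmoothFieldAt (s i) x := fun i => contMDiffAt_localFrame_of_mem ∞ t b i hx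
  -- The coefficients of `W` in the frame solve a linear system with the Gram matrix `A` and
  -- right-hand side `l`, both smooth at `x`; Cramer's rule writes them as quotients of smooth
  -- determinants.
  let A : M → Matrix (Fin (Module.finrank ℝ E)) (Fin (Module.finrank ℝ E)) ℝ :=
    fun y => Matrix.of fun i j => g.inner y (s j y) (s i y)
  let l : M → Fin (Module.finrank ℝ E) → ℝ := fun y i => g.inner y (W y) (s i y)
  let c : M → Fin (Module.finrank ℝ E) → ℝ := fun y i => t.localFrameCoeff 𝓘(ℝ, E) b i y (W y)
  have hsum : ∀ y ∈ t.baseSet, W y = ∑ i, c y i • s i y := fun y hy =>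
    t.eq_sum_localFrameCoeff_smul hy
  have hAc : ∀ y ∈ t.baseSet, (A y).mulVec (c y) = l y := by
    intro y hy
    funext i
    simp only [Matrix.mulVec, dotProduct, A, l, Matrix.of_apply]
    rw [hsum y hy]
    simp [mul_comm]
  -- A kernel vector of the Gram matrix gives a combination of frame vectors orthogonal to itself,
  -- hence zero.
  have hdet : ∀ y ∈ t.baseSet, (A y).det ≠ 0 := by
    intro y hy h0
    obtain ⟨v, hv, hv0⟩ := Matrix.exists_mulVec_eq_zero_iff.mpr h0
    let u : TangentSpace 𝓘(ℝ, E) y := ∑ i, v i • s i y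
    have h1 : ∀ i, g.inner y u (s i y) = 0 := by
      intro i
      have := congrFun hv0 i
      simp only [Matrix.mulVec, dotProduct, A, Matrix.of_apply, Pi.zero_apply] at this
      simp only [u, map_sum, map_smul, sum_apply, smul_apply, smul_eq_mul]
      rw [← this]
      exact Finset.sum_congr rfl fun j _ => mul_comm _ _
    have h2 : g.inner y u u = 0 := by
      change g.inner y u (∑ i, v i • s i y) = 0
      simp [h1]
    have h3 : u = 0 := by
      by_contra hne
      exact (g.pos y u hne).ne' h2
    apply hv
    have hli : LinearIndependent ℝ fun i => s i y :=
      (t.isLocalFrameOn_localFrame_baseSet 𝓘(ℝ, E) 1 b).linearIndependent hy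
    funext i
    exact Fintype.linearIndependent_iff.mp hli v h3 i
  have hcr : ∀ y ∈ t.baseSet, ∀ i, c y i = ((A y).updateCol i (l y)).det * ((A y).det)⁻¹ := by
    intro y hy i
    rw [← Matrix.cramer_apply, ← hAc y hy, Matrix.cramer_eq_adjugate_mulVec, Matrix.mulVec_mulVec,
      Matrix.adjugate_mul, Matrix.smul_mulVec, Matrix.one_mulVec]
    simp only [Pi.smul_apply, smul_eq_mul]
    field_simp [hdet y hy]
  refine (contMDiffAt_iff_localFrameCoeff b hx).mpr fun i => ?_
  have hA : ∀ i j, ContMDiffAt 𝓘(ℝ, E) 𝓘(ℝ) ∞ (fun y => A y i j) x :=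
    fun i j => contMDiffAt_inner g (hs j) (hs i)
  have hd : ContMDiffAt 𝓘(ℝ, E) 𝓘(ℝ) ∞
      (fun y => ((A y).updateCol i (l y)).det * ((A y).det)⁻¹) x := by
    refine ContMDiffAt.mul (contMDiffAt_det fun j k => ?_)
      ((contMDiffAt_det hA).inv₀ (hdet x hx))
    by_cases hk : k = i
    · subst hk
      simp only [Matrix.updateCol_self]
      exact h _ (hs j)
    · simp only [Matrix.updateCol_ne hk]
      exact hA j k
  refine hd.congr_of_eventuallyEq ?_
  filter_upwards [t.open_baseSet.mem_nhds hx] with y hy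
  exact hcr y hy i

/-- An operation on vector fields is smoothly tensorial at `x` if it is additive and linear over
smooth functions. -/
structure SmoothTensorialAt {A : Type*} [AddCommGroup A] [Module ℝ A]
    (Φ : (Π x : M, TangentSpace 𝓘(ℝ, E) x) → A) (x : M) : Prop where
  add : ∀ {X Y : Π x : M, TangentSpace 𝓘(ℝ, E) x}, SmoothFieldAt X x → SmoothFieldAt Y x →
    Φ (X + Y) = Φ X + Φ Y
  smul : ∀ {f : M → ℝ} {X : Π x : M, TangentSpace 𝓘(ℝ, E) x},
    ContMDiffAt 𝓘(ℝ, E) 𝓘(ℝ) ∞ f x → SmoothFieldAt X x → Φ (f • X) = f x • Φ X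

namespace SmoothTensorialAt

variable {A : Type*} [AddCommGroup A] [Module ℝ A]
  {Φ : (Π x : M, TangentSpace 𝓘(ℝ, E) x) → A}

/-- The indicator `ψ` of the set where `X = Y` serves as cut-off. It is identically one near `x`,
hence smooth at `x`, which is all that `smul` asks, and `ψX = ψY` everywhere. -/
theorem congr_of_eventuallyEq (hΦ : SmoothTensorialAt Φ x) (hX : SmoothFieldAt X x)
    (hY : SmoothFieldAt Y x) (h : ∀ᶠ y in 𝓝 x, X y = Y y) : Φ X = Φ Y := by
  classical
  let ψ : M → ℝ := fun y => if X y = Y y then 1 else 0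
  have hψx : ψ x = 1 := by simp [ψ, h.self_of_nhds]
  have hψ : ψ • X = ψ • Y := by
    funext y
    by_cases hy : X y = Y y <;> simp [ψ, hy]
  have hs : ContMDiffAt 𝓘(ℝ, E) 𝓘(ℝ) ∞ ψ x := by
    have : ContMDiffAt 𝓘(ℝ, E) 𝓘(ℝ) ∞ (fun _ : M => (1 : ℝ)) x := contMDiffAt_const
    exact this.congr_of_eventuallyEq (h.mono fun y hy => by simp [ψ, hy])
  have h1 := hΦ.smul hs hX
  have h2 := hΦ.smul hs hY
  rw [hψx, one_smul] at h1 h2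
  rw [← h1, ← h2, hψ]

theorem zero (hΦ : SmoothTensorialAt Φ x) : Φ 0 = 0 := by
  have h0 : SmoothFieldAt (0 : Π x : M, TangentSpace 𝓘(ℝ, E) x) x :=
    Bundle.contMDiff_zeroSection ℝ (TangentSpace 𝓘(ℝ, E) : M → Type _) x
  simpa using hΦ.add h0 h0

theorem sum (hΦ : SmoothTensorialAt Φ x) {ι : Type*} (s : Finset ι)
    (X : ι → Π x : M, TangentSpace 𝓘(ℝ, E) x) (hX : ∀ i, SmoothFieldAt (X i) x) :
    Φ (fun y => ∑ i ∈ s, X i y) = ∑ i ∈ s, Φ (X i) := by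
  classical
  induction s using Finset.induction_on with
  | empty =>
    simp only [Finset.sum_empty]
    exact hΦ.zero
  | insert a s ha h =>
    simp only [Finset.sum_insert ha, ← h]
    exact hΦ.add (hX a) (ContMDiffAt.sum_section fun i _ => hX i)

/-- Near `x` a field is a combination of a local frame with smooth coefficients, so linearity makes
`Φ` depend on the coefficients at `x` alone. -/
theorem pointwise (hΦ : SmoothTensorialAt Φ x) (hX : SmoothFieldAt X x)
    (hY : SmoothFieldAt Y x) (h : X x = Y x) : Φ X = Φ Y := by
  let t := trivializationAt E (TangentSpace 𝓘(ℝ, E) : M → Type _) x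
  have hx : x ∈ t.baseSet :=
    FiberBundle.mem_baseSet_trivializationAt E (TangentSpace 𝓘(ℝ, E) : M → Type _) x
  let b := Module.finBasis ℝ E
  let s := t.localFrame b
  have hs : ∀ i, SmoothFieldAt (s i) x := fun i => contMDiffAt_localFrame_of_mem ∞ t b i hx
  have key : ∀ {Z : Π x : M, TangentSpace 𝓘(ℝ, E) x}, SmoothFieldAt Z x →
      Φ Z = ∑ i, t.localFrameCoeff 𝓘(ℝ, E) b i x (Z x) • Φ (s i) := by
    intro Z hZ
    have hc : ∀ i, ContMDiffAt 𝓘(ℝ, E) 𝓘(ℝ) ∞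
        (fun y => t.localFrameCoeff 𝓘(ℝ, E) b i y (Z y)) x :=
      fun i => contMDiffAt_localFrameCoeff b hx hZ i
    have hcs := fun i => SmoothFieldAt.smul (hc i) (hs i)
    rw [hΦ.congr_of_eventuallyEq hZ (ContMDiffAt.sum_section fun i (_ : i ∈ Finset.univ) => hcs i)
      (t.eventually_eq_localFrame_sum_coeff_smul b hx), hΦ.sum _ _ hcs]
    exact Finset.sum_congr rfl fun i _ => hΦ.smul (hc i) (hs i)
  rw [key hX, key hY, h]

end SmoothTensorialAt

end Frames

/-! ### The Levi-Civita connection, gradients and the pull-back along the identity -/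

section Connections

variable {E : Type*} [NormedAddCommGroup E] [NormedSpace ℝ E] [FiniteDimensional ℝ E]
  {M : Type*} [TopologicalSpace M] [ChartedSpace E M] [IsManifold 𝓘(ℝ, E) ∞ M]
  {X Y Z W : Π x : M, TangentSpace 𝓘(ℝ, E) x} {f : M → ℝ} {x : M}

theorem cov_add (cov : Connection E M) (hX : MDiffAt (T% X) x) (hY : MDiffAt (T% Y) x) :
    cov (X + Y) x = cov X x + cov Y x :=
  cov.isCovariantDerivativeOnUniv.add hX hY

theorem cov_smul (cov : Connection E M) (hf : MDiffAt f x) (hX : MDiffAt (T% X) x)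
    (u : TangentSpace 𝓘(ℝ, E) x) :
    cov (f • X) x u = f x • cov X x u + mvfderiv 𝓘(ℝ, E) f x u • X x := by
  rw [cov.isCovariantDerivativeOnUniv.leibniz hX hf]
  simp

theorem cov_congr (cov : Connection E M) (hX : MDiffAt (T% X) x) (hY : MDiffAt (T% Y) x)
    (h : ∀ᶠ y in 𝓝 x, X y = Y y) : cov X x = cov Y x :=
  cov.isCovariantDerivativeOnUniv.congr_of_eventuallyEq hX hY Filter.univ_mem h

theorem cov_zero_field (cov : Connection E M) (u : TangentSpace 𝓘(ℝ, E) x) :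
    cov (fun _ => 0) x u = 0 := by
  have : cov (0 : Π x : M, TangentSpace 𝓘(ℝ, E) x) x = 0 := by rw [cov.zero]; rfl
  change cov (0 : Π x : M, TangentSpace 𝓘(ℝ, E) x) x u = 0
  rw [this]
  rfl

theorem leviCivita_torsion (g : Metric E M) (hX : MDiffAt (T% X) x) (hY : MDiffAt (T% Y) x) :
    leviCivita g Y x (X x) - leviCivita g X x (Y x) = VectorField.mlieBracket 𝓘(ℝ, E) X Y x :=
  (CovariantDerivative.torsion_eq_zero_iff _).mp (leviCivita_spec g).1 hX hY

theorem leviCivita_metric (g : Metric E M) (hY : MDiffAt (T% Y) x) (hZ : MDiffAt (T% Z) x)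
    (u : TangentSpace 𝓘(ℝ, E) x) :
    mvfderiv 𝓘(ℝ, E) (fun y => g.inner y (Y y) (Z y)) x u
      = g.inner x (leviCivita g Y x u) (Z x) + g.inner x (Y x) (leviCivita g Z x u) :=
  (leviCivita_spec g).2 Y Z x hY hZ u

/-- `leviCivita` is obtained by choice, so the Koszul formula has to be recovered from vanishing
torsion and metric compatibility. -/
theorem inner_leviCivita (g : Metric E M) (hX : MDiffAt (T% X) x) (hY : MDiffAt (T% Y) x)
    (hZ : MDiffAt (T% Z) x) :
    g.inner x (leviCivita g Y x (X x)) (Z x) = koszul g X Y Z x := by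
  unfold koszul
  rw [leviCivita_metric g hY hZ, leviCivita_metric g hZ hX, leviCivita_metric g hX hY,
    ← leviCivita_torsion g hX hY, ← leviCivita_torsion g hZ hX, ← leviCivita_torsion g hY hZ]
  simp only [map_sub, sub_apply, g.symm x (Z x), g.symm x (Y x)]
  rw [g.symm x (X x), g.symm x (X x)]
  ring

/-- Tested against a smooth `Z`, the field becomes the Koszul expression, built from inner products,
derivatives and brackets of smooth fields. -/
theorem SmoothFieldAt.leviCivita (g : Metric E M) (hX : SmoothFieldAt X x)
    (hY : SmoothFieldAt Y x) : SmoothFieldAt (fun y => leviCivita g Y y (X y)) x := by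
  refine smoothFieldAt_of_inner g fun Z hZ => ?_
  have h : ContMDiffAt 𝓘(ℝ, E) 𝓘(ℝ) ∞ (koszul g X Y Z) x := by
    unfold koszul
    refine contMDiffAt_const.mul ?_
    refine ((((ContMDiffAt.add ?_ ?_).sub ?_).add ?_).add ?_).sub ?_
    · exact contMDiffAt_mvfderiv_apply (contMDiffAt_inner g hY hZ) hX
    · exact contMDiffAt_mvfderiv_apply (contMDiffAt_inner g hZ hX) hY
    · exact contMDiffAt_mvfderiv_apply (contMDiffAt_inner g hX hY) hZ
    · exact contMDiffAt_inner g hZ (hX.mlieBracket hY)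
    · exact contMDiffAt_inner g hY (hZ.mlieBracket hX)
    · exact contMDiffAt_inner g hX (hY.mlieBracket hZ)
  refine h.congr_of_eventuallyEq ?_
  filter_upwards [hX.eventually_mdifferentiableAt, hY.eventually_mdifferentiableAt,
    hZ.eventually_mdifferentiableAt] with y h1 h2 h3
  exact inner_leviCivita g h1 h2 h3

theorem inner_grad (g : Metric E M) (α : M → ℝ) (x : M) (u : TangentSpace 𝓘(ℝ, E) x) :
    g.inner x (grad g α x) u = mvfderiv 𝓘(ℝ, E) α x u :=
  flat_symm_inner g x _ _

theorem smoothFieldAt_grad (g : Metric E M) (hf : ContMDiffAt 𝓘(ℝ, E) 𝓘(ℝ) ∞ f x) :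
    SmoothFieldAt (grad g f) x := by
  refine smoothFieldAt_of_inner g fun Z hZ => ?_
  simp only [inner_grad]
  exact contMDiffAt_mvfderiv_apply hf hZ

/-- The Hessian is symmetric. -/
theorem inner_leviCivita_grad_comm (g : Metric E M) (hf : ContMDiffAt 𝓘(ℝ, E) 𝓘(ℝ) ∞ f x)
    (u v : TangentSpace 𝓘(ℝ, E) x) :
    g.inner x (leviCivita g (grad g f) x u) v = g.inner x (leviCivita g (grad g f) x v) u := by
  have hu := smoothFieldAt_extend u
  have hv := smoothFieldAt_extend v
  have hG := smoothFieldAt_grad g hf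
  have h1 := leviCivita_metric g hG.mdifferentiableAt hv.mdifferentiableAt u
  have h2 := leviCivita_metric g hG.mdifferentiableAt hu.mdifferentiableAt v
  have h3 := leviCivita_torsion g hu.mdifferentiableAt hv.mdifferentiableAt
  -- The difference of the two Hessian values is `u(vf) - v(uf) - (∇_u v - ∇_v u) f`, which vanishes
  -- because the torsion does.
  have h4 := mvfderiv_mlieBracket hf hu hv
  rw [← h3, ← inner_grad g] at h4
  simp only [inner_grad, FiberBundle.extend_apply_self, map_sub] at h1 h2 h4
  linarith

/-- On vector fields, the pull-back of a connection along the identity is the connection. -/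
theorem pullbackCov_id (cov : Connection E M) (hW : MDiffAt (T% W) x) :
    pullbackCov cov (id : M → M) W x = cov W x := by
  let t := trivializationAt E (TangentSpace 𝓘(ℝ, E) : M → Type _) x
  have hx : x ∈ t.baseSet :=
    FiberBundle.mem_baseSet_trivializationAt E (TangentSpace 𝓘(ℝ, E) : M → Type _) x
  let c : (Π x : M, TangentSpace 𝓘(ℝ, E) x) → M → E := fun W y => (t ⟨y, W y⟩).2
  have hc : ∀ {W : Π x : M, TangentSpace 𝓘(ℝ, E) x}, MDiffAt (T% W) x → MDiffAt (c W) x := by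
    intro W hW
    exact (mdifferentiableAt_section _ W).mp hW
  have hsymm : ∀ u : TangentSpace 𝓘(ℝ, E) x, t.symmL ℝ x (t ⟨x, u⟩).2 = u := by
    intro u
    rw [Bundle.Trivialization.symmL_apply _ hx]
    exact t.symm_apply_apply_mk hx u
  -- `∇` minus the derivative of coordinates is tensorial, so it can be evaluated on the extension
  -- of `W x`. That extension has constant coordinates, and the value is the second summand of
  -- `pullbackCov`.
  let Φ : (Π x : M, TangentSpace 𝓘(ℝ, E) x) →
      (TangentSpace 𝓘(ℝ, E) x →L[ℝ] TangentSpace 𝓘(ℝ, E) x) :=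
    fun W => cov W x - (t.symmL ℝ x).comp (mvfderiv 𝓘(ℝ, E) (c W) x)
  have hΦ : TensorialAt 𝓘(ℝ, E) E Φ x := by
    constructor
    · intro f W hf hW
      have h1 : c (f • W) =ᶠ[𝓝 x] f • c W := by
        filter_upwards [t.open_baseSet.mem_nhds hx] with y hy
        exact (t.linear ℝ hy).map_smul (f y) (W y)
      have h2 : mvfderiv 𝓘(ℝ, E) (c (f • W)) x = mvfderiv 𝓘(ℝ, E) (f • c W) x := by
        ext u
        simp only [mvfderiv, h1.mfderiv_eq]
        rfl
      ext u
      simp only [Φ]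
      rw [h2, mvfderiv_smul hf (hc hW)]
      simp only [sub_apply, smul_apply, cov_smul cov hf hW, ContinuousLinearMap.comp_apply,
        add_apply, ContinuousLinearMap.smulRight_apply, map_add, map_smul]
      rw [show t.symmL ℝ x (c W x) = W x from hsymm _]
      module
    · intro W W' hW hW'
      have h1 : c (W + W') =ᶠ[𝓝 x] c W + c W' := by
        filter_upwards [t.open_baseSet.mem_nhds hx] with y hy
        exact (t.linear ℝ hy).map_add (W y) (W' y)
      have h2 : mvfderiv 𝓘(ℝ, E) (c (W + W')) x = mvfderiv 𝓘(ℝ, E) (c W + c W') x := by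
        ext u
        simp only [mvfderiv, h1.mfderiv_eq]
        rfl
      simp only [Φ]
      rw [h2, mvfderiv_add (hc hW) (hc hW'), cov_add cov hW hW']
      ext u
      simp only [sub_apply, ContinuousLinearMap.comp_apply, add_apply, map_add]
      abel
  have h1 := hΦ.pointwise hW (mdifferentiableAt_extend_tangent (W x)) (by simp)
  have h2 : mvfderiv 𝓘(ℝ, E) (c (FiberBundle.extend E (W x))) x = 0 := by
    have h3 : c (FiberBundle.extend E (W x)) =ᶠ[𝓝 x] fun _ => (t ⟨x, W x⟩).2 := by
      filter_upwards [t.open_baseSet.mem_nhds hx] with y hy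
      have := congrArg Prod.snd (t.apply_mk_symm hy (t ⟨x, W x⟩).2)
      exact this
    rw [← mvfderiv_const (I := 𝓘(ℝ, E)) (t ⟨x, W x⟩).2 (x := x)]
    ext u
    simp only [mvfderiv, h3.mfderiv_eq]
    rfl
  simp only [Φ, h2, ContinuousLinearMap.comp_zero, sub_zero] at h1
  unfold pullbackCov
  rw [mfderiv_id]
  ext u
  have h4 := congrArg (fun L : TangentSpace 𝓘(ℝ, E) x →L[ℝ] TangentSpace 𝓘(ℝ, E) x => L u) h1
  simp only [sub_apply, sub_eq_iff_eq_add] at h4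
  rw [h4, add_comm]
  rfl

end Connections

/-! ### Metric traces -/

section Traces

variable {E : Type*} [NormedAddCommGroup E] [NormedSpace ℝ E] [FiniteDimensional ℝ E]
  {M : Type*} [TopologicalSpace M] [ChartedSpace E M] [IsManifold 𝓘(ℝ, E) ∞ M]
  {f : M → ℝ} {x : M} {A : Type*} [AddCommGroup A] [Module ℝ A]

theorem sum_inner_smul_orthonormalBasis (g : Metric E M) (u : TangentSpace 𝓘(ℝ, E) x) :
    ∑ i, g.inner x u (orthonormalBasis g x i) • orthonormalBasis g x i = u := by
  have h := (orthonormalBasis g x).sum_repr u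
  have hc : ∀ i, g.inner x u (orthonormalBasis g x i) = (orthonormalBasis g x).repr u i := by
    intro i
    conv_lhs => rw [← h]
    simp only [map_sum, map_smul, sum_apply, smul_apply, orthonormalBasis_spec, smul_eq_mul,
      mul_ite, mul_one, mul_zero, Finset.sum_ite_eq', Finset.mem_univ, if_true]
  simp only [hc, h]

theorem metricTrace_inner (g : Metric E M) :
    (metricTrace g x fun u v => g.inner x u v) = Module.finrank ℝ E := by
  simp [metricTrace, orthonormalBasis_spec]

theorem metricTrace_inner_smul (g : Metric E M) (u : TangentSpace 𝓘(ℝ, E) x)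
    (L : TangentSpace 𝓘(ℝ, E) x →ₗ[ℝ] A) :
    (metricTrace g x fun v w => g.inner x u v • L w) = L u := by
  conv_rhs => rw [← sum_inner_smul_orthonormalBasis g u]
  simp [metricTrace]

theorem metricTrace_add (g : Metric E M)
    (B C : TangentSpace 𝓘(ℝ, E) x → TangentSpace 𝓘(ℝ, E) x → A) :
    (metricTrace g x fun u v => B u v + C u v) = metricTrace g x B + metricTrace g x C :=
  Finset.sum_add_distrib

theorem metricTrace_sub (g : Metric E M)
    (B C : TangentSpace 𝓘(ℝ, E) x → TangentSpace 𝓘(ℝ, E) x → A) :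
    (metricTrace g x fun u v => B u v - C u v) = metricTrace g x B - metricTrace g x C :=
  Finset.sum_sub_distrib ..

theorem metricTrace_smul (g : Metric E M) (c : ℝ)
    (B : TangentSpace 𝓘(ℝ, E) x → TangentSpace 𝓘(ℝ, E) x → A) :
    (metricTrace g x fun u v => c • B u v) = c • metricTrace g x B :=
  Finset.smul_sum.symm

theorem metricTrace_smul_const (g : Metric E M) (a : A)
    (B : TangentSpace 𝓘(ℝ, E) x → TangentSpace 𝓘(ℝ, E) x → ℝ) :
    (metricTrace g x fun u v => B u v • a) = metricTrace g x B • a :=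
  Finset.sum_smul.symm

theorem map_metricTrace (g : Metric E M) {A' : Type*} [AddCommGroup A'] [Module ℝ A']
    (L : A →ₗ[ℝ] A') (B : TangentSpace 𝓘(ℝ, E) x → TangentSpace 𝓘(ℝ, E) x → A) :
    (metricTrace g x fun u v => L (B u v)) = L (metricTrace g x B) :=
  (map_sum ..).symm

/-- The trace with respect to another metric `g'`, where `g(u, v) = g'(S u, v)`. -/
theorem metricTrace_change (g g' : Metric E M)
    {B : TangentSpace 𝓘(ℝ, E) x → TangentSpace 𝓘(ℝ, E) x → A} (hB : IsBilinearMap ℝ B)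
    (S : TangentSpace 𝓘(ℝ, E) x → TangentSpace 𝓘(ℝ, E) x)
    (hS : ∀ u v, g.inner x u v = g'.inner x (S u) v) :
    metricTrace g' x B = metricTrace g x fun u v => B (S u) v := by
  let L := hB.toLinearMap
  change (∑ i, L (orthonormalBasis g' x i) (orthonormalBasis g' x i))
    = ∑ k, L (S (orthonormalBasis g x k)) (orthonormalBasis g x k)
  -- Expand one argument in the `g`-orthonormal basis `e`. After the sums are exchanged, the
  -- coefficients `g(e k, e' i) = g'(S (e k), e' i)` reassemble `S (e k)`.
  have h1 : ∀ i, L (orthonormalBasis g' x i) (orthonormalBasis g' x i)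
      = ∑ k, L (g.inner x (orthonormalBasis g x k) (orthonormalBasis g' x i) •
          orthonormalBasis g' x i) (orthonormalBasis g x k) := by
    intro i
    conv_lhs =>
      enter [2]
      rw [← sum_inner_smul_orthonormalBasis g (orthonormalBasis g' x i)]
    simp [g.symm x (orthonormalBasis g' x i)]
  simp only [h1]
  rw [Finset.sum_comm]
  refine Finset.sum_congr rfl fun k _ => ?_
  conv_rhs => rw [← sum_inner_smul_orthonormalBasis g' (S (orthonormalBasis g x k))]
  simp [hS]

end Traces

/-! ### Second covariant derivatives and curvature as tensors -/

section SecondDerivatives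

variable {E : Type*} [NormedAddCommGroup E] [NormedSpace ℝ E] [FiniteDimensional ℝ E]
  {M : Type*} [TopologicalSpace M] [ChartedSpace E M] [IsManifold 𝓘(ℝ, E) ∞ M]
  {X Y Z W : Π x : M, TangentSpace 𝓘(ℝ, E) x} {f : M → ℝ} {x : M}
  {A : Type*} [AddCommGroup A] [Module ℝ A]

theorem SmoothTensorialAt.extend_add {Φ : (Π x : M, TangentSpace 𝓘(ℝ, E) x) → A}
    (hΦ : SmoothTensorialAt Φ x) (u v : TangentSpace 𝓘(ℝ, E) x) :
    Φ (FiberBundle.extend E (u + v)) = Φ (FiberBundle.extend E u) + Φ (FiberBundle.extend E v) := by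
  have hu := smoothFieldAt_extend u
  have hv := smoothFieldAt_extend v
  rw [← hΦ.add hu hv]
  exact hΦ.pointwise (smoothFieldAt_extend _) (hu.add hv) (by simp)

theorem SmoothTensorialAt.extend_smul {Φ : (Π x : M, TangentSpace 𝓘(ℝ, E) x) → A}
    (hΦ : SmoothTensorialAt Φ x) (c : ℝ) (u : TangentSpace 𝓘(ℝ, E) x) :
    Φ (FiberBundle.extend E (c • u)) = c • Φ (FiberBundle.extend E u) := by
  have hu := smoothFieldAt_extend u
  have hc : ContMDiffAt 𝓘(ℝ, E) 𝓘(ℝ) ∞ (fun _ : M => c) x := contMDiffAt_const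
  rw [← hΦ.smul hc hu]
  exact hΦ.pointwise (smoothFieldAt_extend _) (SmoothFieldAt.smul hc hu) (by simp)

/-- The second covariant derivative `∇²_{u, Y} W = ∇_u ∇_Y W - ∇_{∇_u Y} W` at the point `x`. -/
def secondCov (g : Metric E M) (W : Π x : M, TangentSpace 𝓘(ℝ, E) x) (x : M)
    (u : TangentSpace 𝓘(ℝ, E) x) (Y : Π x : M, TangentSpace 𝓘(ℝ, E) x) :
    TangentSpace 𝓘(ℝ, E) x :=
  leviCivita g (fun y => leviCivita g W y (Y y)) x u - leviCivita g W x (leviCivita g Y x u)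

/-- For `fY`, the term `(uf) ∇_Y W` occurs in both `∇_u ∇_{fY} W` and `∇_{∇_u (fY)} W` and cancels.
-/
theorem secondCov_tensorial (g : Metric E M) (hW : SmoothFieldAt W x)
    (u : TangentSpace 𝓘(ℝ, E) x) : SmoothTensorialAt (secondCov g W x u) x := by
  constructor
  · intro Y Z hY hZ
    have h : (fun y => leviCivita g W y ((Y + Z) y))
        = (fun y => leviCivita g W y (Y y)) + fun y => leviCivita g W y (Z y) := by
      funext y
      simp
    unfold secondCov
    rw [h, cov_add _ (hY.leviCivita g hW).mdifferentiableAt (hZ.leviCivita g hW).mdifferentiableAt,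
      cov_add _ hY.mdifferentiableAt hZ.mdifferentiableAt]
    simp only [add_apply, map_add]
    abel
  · intro f Y hf hY
    have h : (fun y => leviCivita g W y ((f • Y) y)) = f • fun y => leviCivita g W y (Y y) := by
      funext y
      simp
    unfold secondCov
    have hf' := hf.mdifferentiableAt (n := ∞) (by simp)
    rw [h, cov_smul _ hf' (hY.leviCivita g hW).mdifferentiableAt,
      cov_smul _ hf' hY.mdifferentiableAt]
    simp only [map_add, map_smul]
    module

theorem secondCov_isBilinearMap (g : Metric E M) (hW : SmoothFieldAt W x) :
    IsBilinearMap ℝ (fun u v : TangentSpace 𝓘(ℝ, E) x =>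
      secondCov g W x u (FiberBundle.extend E v)) where
  add_left u v w := by simp only [secondCov, map_add]; abel
  smul_left c u w := by simp only [secondCov, map_smul]; module
  add_right u v w := (secondCov_tensorial g hW u).extend_add v w
  smul_right c u v := (secondCov_tensorial g hW u).extend_smul c v

theorem roughLaplacian_eq (g : Metric E M) (W : Π x : M, TangentSpace 𝓘(ℝ, E) x) (x : M) :
    roughLaplacian g W x
      = - metricTrace g x fun u v => secondCov g W x u (FiberBundle.extend E v) := rfl

theorem eventually_leviCivita_smul (g : Metric E M) (hf : ContMDiffAt 𝓘(ℝ, E) 𝓘(ℝ) ∞ f x)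
    (hZ : SmoothFieldAt Z x) : ∀ᶠ y in 𝓝 x, leviCivita g (f • Z) y (Y y)
      = ((f • fun y => leviCivita g Z y (Y y))
          + (fun y => mvfderiv 𝓘(ℝ, E) f y (Y y)) • Z : Π y : M, TangentSpace 𝓘(ℝ, E) y) y := by
  filter_upwards [eventually_mdifferentiableAt_of_contMDiffAt hf,
    hZ.eventually_mdifferentiableAt] with y hfy hZy
  exact cov_smul _ hfy hZy _

theorem leviCivita_leviCivita_smul (g : Metric E M) (hf : ContMDiffAt 𝓘(ℝ, E) 𝓘(ℝ) ∞ f x)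
    (hY : SmoothFieldAt Y x) (hZ : SmoothFieldAt Z x) (u : TangentSpace 𝓘(ℝ, E) x) :
    leviCivita g (fun y => leviCivita g (f • Z) y (Y y)) x u
      = f x • leviCivita g (fun y => leviCivita g Z y (Y y)) x u
        + mvfderiv 𝓘(ℝ, E) f x u • leviCivita g Z x (Y x)
        + mvfderiv 𝓘(ℝ, E) f x (Y x) • leviCivita g Z x u
        + mvfderiv 𝓘(ℝ, E) (fun y => mvfderiv 𝓘(ℝ, E) f y (Y y)) x u • Z x := by
  have hfY := contMDiffAt_mvfderiv_apply hf hY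
  have h1 : SmoothFieldAt (f • fun y => leviCivita g Z y (Y y)) x :=
    SmoothFieldAt.smul hf (hY.leviCivita g hZ)
  have h2 : SmoothFieldAt ((fun y => mvfderiv 𝓘(ℝ, E) f y (Y y)) • Z) x :=
    SmoothFieldAt.smul hfY hZ
  have hf' := hf.mdifferentiableAt (n := ∞) (by simp)
  rw [cov_congr _ (hY.leviCivita g (SmoothFieldAt.smul hf hZ)).mdifferentiableAt
    (h1.add h2).mdifferentiableAt (eventually_leviCivita_smul g hf hZ),
    cov_add _ h1.mdifferentiableAt h2.mdifferentiableAt,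
    add_apply, cov_smul _ hf' (hY.leviCivita g hZ).mdifferentiableAt,
    cov_smul _ (hfY.mdifferentiableAt (by simp)) hZ.mdifferentiableAt]
  module

theorem secondCov_smul (g : Metric E M) (hf : ContMDiffAt 𝓘(ℝ, E) 𝓘(ℝ) ∞ f x)
    (hW : SmoothFieldAt W x) (hY : SmoothFieldAt Y x) (u : TangentSpace 𝓘(ℝ, E) x) :
    secondCov g (f • W) x u Y = f x • secondCov g W x u Y
      + mvfderiv 𝓘(ℝ, E) f x u • leviCivita g W x (Y x)
      + mvfderiv 𝓘(ℝ, E) f x (Y x) • leviCivita g W x u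
      + (mvfderiv 𝓘(ℝ, E) (fun y => mvfderiv 𝓘(ℝ, E) f y (Y y)) x u
          - mvfderiv 𝓘(ℝ, E) f x (leviCivita g Y x u)) • W x := by
  unfold secondCov
  rw [leviCivita_leviCivita_smul g hf hY hW, cov_smul _ (hf.mdifferentiableAt (by simp))
    hW.mdifferentiableAt]
  module

theorem curvatureField_swap (cov : Connection E M) :
    curvatureField cov X Y Z x = - curvatureField cov Y X Z x := by
  unfold curvatureField
  rw [VectorField.mlieBracket_swap_apply, map_neg]
  abel

/-- The term `(Xf) ∇_Y Z` from `∇_X (f ∇_Y Z)` cancels against the one from `[X, fY]`. -/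
theorem curvatureField_tensorial_middle (g : Metric E M) (hZ : SmoothFieldAt Z x) :
    SmoothTensorialAt (fun Y => curvatureField (leviCivita g) X Y Z x) x := by
  constructor
  · intro Y Y' hY hY'
    have h : (fun y => leviCivita g Z y ((Y + Y') y))
        = (fun y => leviCivita g Z y (Y y)) + fun y => leviCivita g Z y (Y' y) := by
      funext y
      simp
    unfold curvatureField
    rw [h, cov_add _ (hY.leviCivita g hZ).mdifferentiableAt
      (hY'.leviCivita g hZ).mdifferentiableAt,
      VectorField.mlieBracket_add_right hY.mdifferentiableAt hY'.mdifferentiableAt]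
    simp only [add_apply, map_add, Pi.add_apply]
    abel
  · intro f Y hf hY
    have h : (fun y => leviCivita g Z y ((f • Y) y)) = f • fun y => leviCivita g Z y (Y y) := by
      funext y
      simp
    have hf' := hf.mdifferentiableAt (n := ∞) (by simp)
    unfold curvatureField
    rw [h, cov_smul _ hf' (hY.leviCivita g hZ).mdifferentiableAt,
      VectorField.mlieBracket_smul_right hf' hY.mdifferentiableAt]
    simp only [map_add, map_smul, Pi.smul_apply']
    module

theorem curvatureField_tensorial_left (g : Metric E M) (hZ : SmoothFieldAt Z x) :
    SmoothTensorialAt (fun X => curvatureField (leviCivita g) X Y Z x) x := by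
  have h := curvatureField_tensorial_middle (X := Y) g hZ
  constructor
  · intro X X' hX hX'
    simp only [curvatureField_swap (X := X + X'), curvatureField_swap (X := X),
      curvatureField_swap (X := X'), h.add hX hX', neg_add]
  · intro f X hf hX
    simp only [curvatureField_swap (X := f • X), curvatureField_swap (X := X), h.smul hf hX,
      smul_neg]

theorem leviCivita_leviCivita_add (g : Metric E M) {Z' : Π x : M, TangentSpace 𝓘(ℝ, E) x}
    (hY : SmoothFieldAt Y x) (hZ : SmoothFieldAt Z x) (hZ' : SmoothFieldAt Z' x) :
    leviCivita g (fun y => leviCivita g (Z + Z') y (Y y)) x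
      = leviCivita g (fun y => leviCivita g Z y (Y y)) x
        + leviCivita g (fun y => leviCivita g Z' y (Y y)) x := by
  have h1 := hY.leviCivita g hZ
  have h2 := hY.leviCivita g hZ'
  rw [← cov_add _ h1.mdifferentiableAt h2.mdifferentiableAt]
  refine cov_congr _ (hY.leviCivita g (hZ.add hZ')).mdifferentiableAt
    (h1.add h2).mdifferentiableAt ?_
  filter_upwards [hZ.eventually_mdifferentiableAt, hZ'.eventually_mdifferentiableAt] with y h h'
  simp [cov_add _ h h']

/-- First derivatives of `f` cancel by antisymmetry; the second-order part is `(XYf - YXf - [X,Y]f)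
Z`, zero by `mvfderiv_mlieBracket`. -/
theorem curvatureField_tensorial_right (g : Metric E M) (hX : SmoothFieldAt X x)
    (hY : SmoothFieldAt Y x) :
    SmoothTensorialAt (fun Z => curvatureField (leviCivita g) X Y Z x) x := by
  constructor
  · intro Z Z' hZ hZ'
    unfold curvatureField
    rw [leviCivita_leviCivita_add g hY hZ hZ', leviCivita_leviCivita_add g hX hZ hZ',
      cov_add _ hZ.mdifferentiableAt hZ'.mdifferentiableAt]
    simp only [add_apply]
    abel
  · intro f Z hf hZ
    unfold curvatureField
    rw [leviCivita_leviCivita_smul g hf hY hZ, leviCivita_leviCivita_smul g hf hX hZ,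
      cov_smul _ (hf.mdifferentiableAt (by simp)) hZ.mdifferentiableAt,
      mvfderiv_mlieBracket hf hX hY]
    module

theorem curvature_smul_left (g : Metric E M) (c : ℝ) (u v w : TangentSpace 𝓘(ℝ, E) x) :
    curvature (leviCivita g) x (c • u) v w = c • curvature (leviCivita g) x u v w :=
  (curvatureField_tensorial_left g (smoothFieldAt_extend w)).extend_smul
    c u

theorem curvature_isBilinearMap (g : Metric E M) (u : TangentSpace 𝓘(ℝ, E) x) :
    IsBilinearMap ℝ (curvature (leviCivita g) x u) where
  add_left v v' w := (curvatureField_tensorial_middle g (smoothFieldAt_extend w)).extend_add v v'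
  smul_left c v w := (curvatureField_tensorial_middle g (smoothFieldAt_extend w)).extend_smul c v
  add_right v w w' := (curvatureField_tensorial_right g (smoothFieldAt_extend u)
    (smoothFieldAt_extend v)).extend_add w w'
  smul_right c v w := (curvatureField_tensorial_right g (smoothFieldAt_extend u)
    (smoothFieldAt_extend v)).extend_smul c w

/-- The curvature annihilates parallel vector fields. -/
theorem curvature_apply_parallel (g : Metric E M) (hZ : SmoothFieldAt Z x)
    (hZp : ∀ y, leviCivita g Z y = 0) (u v : TangentSpace 𝓘(ℝ, E) x) :
    curvature (leviCivita g) x u v (Z x) = 0 := by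
  unfold curvature
  rw [(curvatureField_tensorial_right g (smoothFieldAt_extend u) (smoothFieldAt_extend v)).pointwise
    (smoothFieldAt_extend (Z x)) hZ (by simp)]
  simp [curvatureField, hZp, cov_zero_field]

end SecondDerivatives

/-! ### Chain rule, and functions with vanishing derivative -/

section Functions

variable {E : Type*} [NormedAddCommGroup E] [NormedSpace ℝ E]
  {M : Type*} [TopologicalSpace M] [ChartedSpace E M] [IsManifold 𝓘(ℝ, E) ∞ M]
  {α : M → ℝ} {x : M}

theorem mvfderiv_scalar_comp {h : ℝ → ℝ} {h' : ℝ} (hh : HasDerivAt h h' (α x))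
    (hα : MDiffAt α x) (u : TangentSpace 𝓘(ℝ, E) x) :
    mvfderiv 𝓘(ℝ, E) (fun y => h (α y)) x u = h' * mvfderiv 𝓘(ℝ, E) α x u := by
  have h1 := (hh.hasFDerivAt.hasMFDerivAt.comp x hα.hasMFDerivAt).mfderiv
  change NormedSpace.fromTangentSpace _ (mfderiv 𝓘(ℝ, E) 𝓘(ℝ) (h ∘ α) x u) = _
  rw [h1]
  exact mul_comm _ _

/-- A differentiable function on a connected manifold whose derivative vanishes is constant. -/
theorem exists_eq_const_of_mvfderiv_eq_zero [PreconnectedSpace M]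
    (hα : MDifferentiable 𝓘(ℝ, E) 𝓘(ℝ) α) (h : ∀ x, mvfderiv 𝓘(ℝ, E) α x = 0) :
    ∃ c : ℝ, ∀ x, α x = c := by
  rcases isEmpty_or_nonempty M with hM | ⟨⟨x₀⟩⟩
  · exact ⟨0, fun x => hM.elim x⟩
  have h0 : ∀ x, mfderiv 𝓘(ℝ, E) 𝓘(ℝ) α x = 0 := by
    intro x
    ext u
    exact congrArg (fun L : TangentSpace 𝓘(ℝ, E) x →L[ℝ] ℝ => L u) (h x)
  have hloc : IsLocallyConstant α := by
    rw [IsLocallyConstant.iff_eventually_eq]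
    intro x
    let φ := extChartAt 𝓘(ℝ, E) x
    have hopen : IsOpen φ.target := isOpen_extChartAt_target x
    obtain ⟨r, hr, hball⟩ := Metric.isOpen_iff.mp hopen (φ x) (mem_extChartAt_target x)
    have hd : ∀ z ∈ φ.target, HasMFDerivAt 𝓘(ℝ, E) 𝓘(ℝ) (α ∘ φ.symm) z 0 := by
      intro z hz
      have h1 : MDifferentiableAt 𝓘(ℝ, E) 𝓘(ℝ, E) φ.symm z :=
        ((contMDiffOn_extChartAt_symm (n := ∞) x).contMDiffAt
          (hopen.mem_nhds hz)).mdifferentiableAt (by simp)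
      have h2 := (hα (φ.symm z)).hasMFDerivAt.comp z h1.hasMFDerivAt
      rw [h0] at h2
      simpa using h2
    have hd' : ∀ z ∈ φ.target, HasFDerivAt (α ∘ φ.symm) (0 : E →L[ℝ] ℝ) z :=
      fun z hz => hasMFDerivAt_iff_hasFDerivAt.mp (hd z hz)
    -- In the chart, the ball is convex and the derivative vanishes on it.
    have hconst : ∀ z ∈ Metric.ball (φ x) r, α (φ.symm z) = α x := by
      intro z hz
      have h3 := (convex_ball (φ x) r).is_const_of_fderivWithin_eq_zero (𝕜 := ℝ)
        (f := α ∘ φ.symm) (fun y hy => ?_) (fun y hy => ?_) hz (Metric.mem_ball_self hr)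
      · rw [Function.comp_apply, Function.comp_apply, extChartAt_to_inv] at h3
        exact h3
      · exact (hd' y (hball hy)).differentiableAt.differentiableWithinAt
      · exact (hd' y (hball hy)).hasFDerivWithinAt.fderivWithin
          (Metric.isOpen_ball.uniqueDiffWithinAt hy)
    have hnear : ∀ᶠ y in 𝓝 x, φ y ∈ Metric.ball (φ x) r :=
      (continuousAt_extChartAt x).eventually (Metric.ball_mem_nhds _ hr)
    filter_upwards [hnear, extChartAt_source_mem_nhds (I := 𝓘(ℝ, E)) x] with y hy hys
    rw [← hconst _ hy, φ.left_inv hys]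
  exact ⟨α x₀, fun x => hloc.apply_eq_of_preconnectedSpace x x₀⟩

end Functions

/-! ### Tension and bitension of the identity between two metrics -/

section Identity

variable {E : Type*} [NormedAddCommGroup E] [NormedSpace ℝ E] [FiniteDimensional ℝ E]
  {M : Type*} [TopologicalSpace M] [ChartedSpace E M] [IsManifold 𝓘(ℝ, E) ∞ M]
  {x : M}

/-- The differential of the identity is the identity and the pull-back connection is `∇`. The
difference of two connections is a tensor, so the tension field becomes an algebraic expression once
that tensor is known. -/
theorem tension_id (g' g : Metric E M) (x : M) :
    tension g' g (id : M → M) x = metricTrace g' x fun u v =>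
      leviCivita g (FiberBundle.extend E v) x u - leviCivita g' (FiberBundle.extend E v) x u := by
  unfold tension metricTrace
  refine Finset.sum_congr rfl fun i _ => ?_
  have h : (fun y => mfderiv 𝓘(ℝ, E) 𝓘(ℝ, E) (id : M → M) y
      (FiberBundle.extend E (orthonormalBasis g' x i) y))
      = FiberBundle.extend E (orthonormalBasis g' x i) := by
    funext y
    rw [mfderiv_id]
    rfl
  beta_reduce
  rw [h, pullbackCov_id _ (mdifferentiableAt_extend_tangent _), mfderiv_id]
  rfl

/-- The operator contains `∇_{∇'_u v} W`. Replacing `∇'` by `∇` there costs `W` differentiated along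
`(∇ - ∇')_u v`, whose trace is the tension field. -/
theorem roughLaplacianAlong_id (g' g : Metric E M) {W : Π x : M, TangentSpace 𝓘(ℝ, E) x}
    (hW : SmoothField W) (x : M) :
    roughLaplacianAlong g' g (id : M → M) W x
      = - (metricTrace g' x fun u v => secondCov g W x u (FiberBundle.extend E v))
        - leviCivita g W x (tension g' g (id : M → M) x) := by
  have h : ∀ Y : Π x : M, TangentSpace 𝓘(ℝ, E) x,
      (fun y => pullbackCov (leviCivita g) (id : M → M) W y (Y y))
        = fun y => leviCivita g W y (Y y) := by
    intro Y
    funext y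
    rw [pullbackCov_id _ (hW.smoothFieldAt y).mdifferentiableAt]
  have h2 : roughLaplacianAlong g' g (id : M → M) W x = - metricTrace g' x fun u v =>
      secondCov g W x u (FiberBundle.extend E v)
        + leviCivita g W x (leviCivita g (FiberBundle.extend E v) x u
            - leviCivita g' (FiberBundle.extend E v) x u) := by
    unfold roughLaplacianAlong metricTrace
    congr 1
    refine Finset.sum_congr rfl fun i _ => ?_
    beta_reduce
    rw [h, pullbackCov_id _ (hW.smoothFieldAt x).mdifferentiableAt, pullbackCov_id _
      ((smoothFieldAt_extend _).leviCivita g (hW.smoothFieldAt x)).mdifferentiableAt]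
    simp only [secondCov, map_sub]
    change leviCivita g (fun y => leviCivita g W y (FiberBundle.extend E _ y)) x _
      - leviCivita g W x _ = _
    abel
  rw [h2, metricTrace_add, tension_id, neg_add, sub_eq_add_neg]
  congr 2
  exact map_metricTrace g' (leviCivita g W x).toLinearMap _

theorem bitension_id (g' g : Metric E M) (hW : SmoothField (tension g' g (id : M → M))) (x : M) :
    bitension g' g (id : M → M) x
      = - (metricTrace g' x fun u v =>
            secondCov g (tension g' g (id : M → M)) x u (FiberBundle.extend E v))
        - leviCivita g (tension g' g (id : M → M)) x (tension g' g (id : M → M) x)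
        - metricTrace g' x (curvature (leviCivita g) x (tension g' g (id : M → M) x)) := by
  unfold bitension
  rw [roughLaplacianAlong_id g' g hW, mfderiv_id]
  rfl

end Identity

/-! ### The deformed metric `α (g + ξ♭ ⊗ ξ♭)` -/

section Deformation

variable {E : Type*} [NormedAddCommGroup E] [NormedSpace ℝ E] [FiniteDimensional ℝ E]
  {M : Type*} [TopologicalSpace M] [ChartedSpace E M] [IsManifold 𝓘(ℝ, E) ∞ M]

/-- `g' = α (g + ξ♭ ⊗ ξ♭)` for a `g`-parallel unit vector field `ξ` and a positive function `α`
that is constant along `ξ`. -/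
structure IsParallelDeformation (g g' : Metric E M) (ξ : Π x : M, TangentSpace 𝓘(ℝ, E) x)
    (α : M → ℝ) : Prop where
  smooth_field : SmoothField ξ
  unit : ∀ x, g.inner x (ξ x) (ξ x) = 1
  parallel : ∀ x, leviCivita g ξ x = 0
  smooth : ContMDiff 𝓘(ℝ, E) 𝓘(ℝ) ∞ α
  pos : ∀ x, 0 < α x
  deriv_eq_zero : ∀ x, mvfderiv 𝓘(ℝ, E) α x (ξ x) = 0
  inner_eq : ∀ x u v, g'.inner x u v
    = α x * (g.inner x u v + g.inner x u (ξ x) * g.inner x v (ξ x))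

namespace IsParallelDeformation

variable {g g' : Metric E M} {ξ : Π x : M, TangentSpace 𝓘(ℝ, E) x} {α : M → ℝ}
  {A : Type*} [AddCommGroup A] [Module ℝ A] (h : IsParallelDeformation g g' ξ α)
include h

theorem mdifferentiableAt (x : M) : MDiffAt α x := (h.smooth x).mdifferentiableAt (by simp)

/-- The endomorphism `S` with `g = g'(S·, ·)` divides by `α` on the complement of `ξ` and by `2α`
along `ξ`, because `1 + g(ξ, ξ) = 2`; hence the factor `1/2`. -/
theorem metricTrace_eq {x : M} {B : TangentSpace 𝓘(ℝ, E) x → TangentSpace 𝓘(ℝ, E) x → A}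
    (hB : IsBilinearMap ℝ B) :
    metricTrace g' x B
      = (1 / α x) • (metricTrace g x B - (1 / 2 : ℝ) • B (ξ x) (ξ x)) := by
  have hα := (h.pos x).ne'
  rw [metricTrace_change g g' hB
    (fun u => (1 / α x) • (u - (1 / 2 * g.inner x (ξ x) u) • ξ x))]
  · have h1 : ∀ u v, B ((1 / α x) • (u - (1 / 2 * g.inner x (ξ x) u) • ξ x)) v
        = (1 / α x) • (B u v - (1 / 2 : ℝ) • (g.inner x (ξ x) u • B (ξ x) v)) := by
      intro u v
      change hB.toLinearMap _ _ = (1 / α x) • (hB.toLinearMap _ _ -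
        (1 / 2 : ℝ) • (g.inner x (ξ x) u • hB.toLinearMap _ _))
      simp only [map_smul, map_sub, LinearMap.smul_apply, LinearMap.sub_apply, mul_smul]
    simp only [h1]
    rw [metricTrace_smul, metricTrace_sub, metricTrace_smul]
    congr 3
    exact metricTrace_inner_smul g (ξ x) (hB.toLinearMap (ξ x))
  · intro u v
    rw [h.inner_eq]
    simp only [map_smul, map_sub, smul_apply, sub_apply, smul_eq_mul, h.unit, g.symm x u (ξ x),
      g.symm x v (ξ x)]
    field_simp
    ring

theorem inner_grad_field (x : M) : g.inner x (grad g α x) (ξ x) = 0 := by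
  rw [inner_grad, h.deriv_eq_zero]

/-- The difference of the Levi-Civita connections. -/
theorem leviCivita_sub (x : M) (u v : TangentSpace 𝓘(ℝ, E) x) :
    leviCivita g (FiberBundle.extend E v) x u - leviCivita g' (FiberBundle.extend E v) x u
      = (-(1 / (2 * α x))) • (g.inner x (grad g α x) u • v + g.inner x (grad g α x) v • u
          - (g.inner x u v + g.inner x (ξ x) u * g.inner x (ξ x) v) • grad g α x) := by
  have hα := (h.pos x).ne'
  have hE : ∀ w : TangentSpace 𝓘(ℝ, E) x, MDiffAt (T% (FiberBundle.extend E w)) x :=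
    mdifferentiableAt_extend_tangent
  have hξ := (h.smooth_field.smoothFieldAt x).mdifferentiableAt
  -- The difference `∇' - ∇`, lowered with `g'`. It is symmetric in `u, v` since both connections
  -- are torsion free, and its symmetrization in `v, w` is `(∇_u g')(v, w)`, where only `α` is
  -- differentiated because `ξ` is parallel. These two facts determine `T` as in the Koszul formula.
  let T : TangentSpace 𝓘(ℝ, E) x → TangentSpace 𝓘(ℝ, E) x → TangentSpace 𝓘(ℝ, E) x → ℝ :=
    fun u v w => g'.inner x (leviCivita g' (FiberBundle.extend E v) x u
      - leviCivita g (FiberBundle.extend E v) x u) w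
  have hsymm : ∀ u v w, T u v w = T v u w := by
    intro u v w
    have h1 := leviCivita_torsion g (hE u) (hE v)
    have h2 := leviCivita_torsion g' (hE u) (hE v)
    simp only [FiberBundle.extend_apply_self] at h1 h2
    rw [← h2] at h1
    have h3 : leviCivita g' (FiberBundle.extend E v) x u - leviCivita g (FiberBundle.extend E v) x u
        = leviCivita g' (FiberBundle.extend E u) x v
          - leviCivita g (FiberBundle.extend E u) x v := by
      rw [sub_eq_sub_iff_add_eq_add] at h1 ⊢
      rw [← sub_eq_zero] at h1 ⊢
      rw [← neg_eq_zero, ← h1]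
      abel
    simp only [T, h3]
  have hmetric : ∀ u v w, T u v w + T u w v = mvfderiv 𝓘(ℝ, E) α x u
      * (g.inner x v w + g.inner x v (ξ x) * g.inner x w (ξ x)) := by
    intro u v w
    have h1 := leviCivita_metric g' (hE v) (hE w) u
    have h2 := leviCivita_metric g (hE v) (hE w) u
    have h3 := leviCivita_metric g (hE v) hξ u
    have h4 := leviCivita_metric g (hE w) hξ u
    have hvw := mdiffAt_inner g (hE v) (hE w)
    have hv := mdiffAt_inner g (hE v) hξ
    have hw := mdiffAt_inner g (hE w) hξ
    have h5 : (fun y => g'.inner y (FiberBundle.extend E v y) (FiberBundle.extend E w y))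
        = α * ((fun y => g.inner y (FiberBundle.extend E v y) (FiberBundle.extend E w y))
          + (fun y => g.inner y (FiberBundle.extend E v y) (ξ y))
            * fun y => g.inner y (FiberBundle.extend E w y) (ξ y)) := by
      funext y
      exact h.inner_eq y _ _
    rw [h5, mvfderiv_mul (h.mdifferentiableAt x) (hvw.add (hv.mul hw)),
      mvfderiv_add hvw (hv.mul hw), mvfderiv_mul hv hw] at h1
    simp only [add_apply, smul_apply, Pi.add_apply, Pi.mul_apply, smul_eq_mul, h2, h3, h4,
      h.parallel, FiberBundle.extend_apply_self, h.inner_eq, zero_apply, map_zero] at h1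
    simp only [T, map_sub, sub_apply, h.inner_eq]
    rw [g.symm x v (leviCivita g (FiberBundle.extend E w) x u),
      g.symm x v (leviCivita g' (FiberBundle.extend E w) x u)] at h1
    linarith
  have hT : ∀ w, T u v w = (1 / 2) * (mvfderiv 𝓘(ℝ, E) α x u
        * (g.inner x v w + g.inner x v (ξ x) * g.inner x w (ξ x))
      + mvfderiv 𝓘(ℝ, E) α x v * (g.inner x u w + g.inner x u (ξ x) * g.inner x w (ξ x))
      - mvfderiv 𝓘(ℝ, E) α x w * (g.inner x u v + g.inner x u (ξ x) * g.inner x v (ξ x))) := by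
    intro w
    have e1 := hmetric u v w
    have e2 := hmetric v w u
    have e3 := hmetric w u v
    rw [hsymm v w u, hsymm v u w] at e2
    rw [hsymm w u v] at e3
    rw [g.symm x w u] at e2
    linarith
  rw [← neg_sub, neg_smul]
  congr 1
  apply inner_injective g' x
  ext w
  change T u v w = _
  rw [hT w]
  simp only [map_smul, map_sub, map_add, smul_apply, add_apply, sub_apply, smul_eq_mul, h.inner_eq,
    ← inner_grad g, h.inner_grad_field, g.symm x (ξ x)]
  field_simp
  ring

/-- Inside the bracket of `leviCivita_sub` the `g`-trace is `2 - (2m + 1)` times `grad α`, and the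
`(ξ, ξ)` correction adds `1`. The total `2 - 2m` is multiplied by `1/α` and by `-1/(2α)`. -/
theorem tension_id_eq {m : ℕ} (hm : Module.finrank ℝ E = 2 * m) (x : M) :
    tension g' g (id : M → M) x = (((m : ℝ) - 1) / α x ^ 2) • grad g α x := by
  have hα := (h.pos x).ne'
  rw [tension_id]
  simp only [h.leviCivita_sub]
  rw [metricTrace_smul, h.metricTrace_eq, metricTrace_sub, metricTrace_add, metricTrace_smul_const,
    metricTrace_add, metricTrace_inner, hm]
  · have h1 : (metricTrace g x fun u v => g.inner x (grad g α x) u • v) = grad g α x :=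
      metricTrace_inner_smul g (grad g α x) LinearMap.id
    have h2 : (metricTrace g x fun u v => g.inner x (grad g α x) v • u) = grad g α x := h1
    have h3 : (metricTrace g x fun u v => g.inner x (ξ x) u * g.inner x (ξ x) v) = 1 :=
      (metricTrace_inner_smul g (ξ x) (g.inner x (ξ x)).toLinearMap).trans (h.unit x)
    rw [h1, h2, h3, h.inner_grad_field, h.unit]
    match_scalars
    · field_simp
      ring
    · simp
  · constructor
    · intro u v w
      simp only [map_add, add_apply]
      module
    · intro c u v
      simp only [map_smul, smul_apply, smul_eq_mul]
      module
    · intro u v w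
      simp only [map_add]
      module
    · intro c u v
      simp only [map_smul, smul_eq_mul]
      module

theorem smoothField_grad : SmoothField (grad g α) := fun x => smoothFieldAt_grad g (h.smooth x)

/-- Differentiating `g(grad α, ξ) = 0` with `ξ` parallel gives `g(∇_u grad α, ξ) = 0`; symmetry of
the Hessian exchanges `u` and `ξ`. -/
theorem leviCivita_grad_field (x : M) : leviCivita g (grad g α) x (ξ x) = 0 := by
  apply inner_injective g x
  ext u
  rw [inner_leviCivita_grad_comm g (h.smooth x)]
  have h1 := leviCivita_metric g (smoothFieldAt_grad g (h.smooth x)).mdifferentiableAt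
    (h.smooth_field.smoothFieldAt x).mdifferentiableAt u
  have h2 : (fun y => g.inner y (grad g α y) (ξ y)) = 0 := funext h.inner_grad_field
  rw [h2, mvfderiv_zero, h.parallel] at h1
  simp only [zero_apply, map_zero, add_zero] at h1
  rw [← h1]
  simp

theorem mvfderiv_const_div_pow (c : ℝ) (n : ℕ) (x : M) (u : TangentSpace 𝓘(ℝ, E) x) :
    mvfderiv 𝓘(ℝ, E) (fun y => c / α y ^ n) x u
      = -(n * c) / α x ^ (n + 1) * mvfderiv 𝓘(ℝ, E) α x u := by
  have hα := (h.pos x).ne'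
  refine mvfderiv_scalar_comp (h := fun t => c / t ^ n) ?_ (h.mdifferentiableAt x) u
  have h1 := (hasDerivAt_const (α x) c).div (hasDerivAt_pow n (α x)) (pow_ne_zero n hα)
  refine h1.congr_deriv ?_
  rcases n with _ | n
  · simp
  · simp only [Nat.add_sub_cancel]
    field_simp
    ring

theorem contMDiff_const_div_pow (c : ℝ) (n : ℕ) :
    ContMDiff 𝓘(ℝ, E) 𝓘(ℝ) ∞ (fun y => c / α y ^ n) :=
  contMDiff_const.div₀ (h.smooth.pow n) fun x => pow_ne_zero n (h.pos x).ne'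

/-- The second covariant derivative of `(c / α²) grad α`, traced with respect to `g'`. -/
theorem metricTrace_secondCov (c : ℝ) (x : M) :
    (metricTrace g' x fun u v =>
        secondCov g ((fun y => c / α y ^ 2) • grad g α) x u (FiberBundle.extend E v))
      = (1 / α x) • (-(c / α x ^ 2) • roughLaplacian g (grad g α) x
          - (4 * c / α x ^ 3) • leviCivita g (grad g α) x (grad g α x)
          + (6 * c / α x ^ 4 * g.inner x (grad g α x) (grad g α x)
              - 2 * c / α x ^ 3 * laplacian g α x) • grad g α x) := by
  have hf := h.contMDiff_const_div_pow c 2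
  have hG := h.smoothField_grad
  have hW : SmoothField ((fun y => c / α y ^ 2) • grad g α) :=
    fun y => SmoothFieldAt.smul (hf y) (hG y)
  -- The `(ξ, ξ)` correction of the trace vanishes: extending by the parallel field `ξ` itself, the
  -- derivative of `c α⁻² grad α` along `ξ` is identically zero.
  have hzero : secondCov g ((fun y => c / α y ^ 2) • grad g α) x (ξ x)
      (FiberBundle.extend E (ξ x)) = 0 := by
    rw [(secondCov_tensorial g (hW x) (ξ x)).pointwise (smoothFieldAt_extend (ξ x))
      (h.smooth_field x) (by simp)]
    have h1 : (fun y => leviCivita g ((fun y => c / α y ^ 2) • grad g α) y (ξ y))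
        = fun y => 0 := by
      funext y
      rw [cov_smul _ ((hf y).mdifferentiableAt (by simp)) (SmoothFieldAt.mdifferentiableAt (hG y)),
        h.leviCivita_grad_field, h.mvfderiv_const_div_pow, h.deriv_eq_zero]
      simp
    simp only [secondCov, h1, cov_zero_field, h.parallel]
    simp
  have hsecond : ∀ u v : TangentSpace 𝓘(ℝ, E) x,
      secondCov g ((fun y => c / α y ^ 2) • grad g α) x u (FiberBundle.extend E v)
      = (c / α x ^ 2) • secondCov g (grad g α) x u (FiberBundle.extend E v)
        + (-2 * c / α x ^ 3) • (g.inner x (grad g α x) u • leviCivita g (grad g α) x v)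
        + (-2 * c / α x ^ 3) • (g.inner x (grad g α x) v • leviCivita g (grad g α) x u)
        + ((6 * c / α x ^ 4) • (g.inner x (grad g α x) u * g.inner x (grad g α x) v)
            + (-2 * c / α x ^ 3) • g.inner x (leviCivita g (grad g α) x u) v) • grad g α x := by
    intro u v
    have hv := smoothFieldAt_extend v
    have h2 : (fun y => mvfderiv 𝓘(ℝ, E) (fun y => c / α y ^ 2) y (FiberBundle.extend E v y))
        = (fun y => (-2 * c) / α y ^ 3)
          * fun y => g.inner y (grad g α y) (FiberBundle.extend E v y) := by
      funext y
      rw [h.mvfderiv_const_div_pow]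
      simp [inner_grad]
    have h3 := leviCivita_metric g (SmoothFieldAt.mdifferentiableAt (hG x)) hv.mdifferentiableAt u
    rw [secondCov_smul g (hf x) (hG x) hv, h2, mvfderiv_mul
      ((h.contMDiff_const_div_pow (-2 * c) 3 x).mdifferentiableAt (by simp))
      (mdiffAt_inner g (SmoothFieldAt.mdifferentiableAt (hG x)) hv.mdifferentiableAt)]
    simp only [add_apply, smul_apply, h3, h.mvfderiv_const_div_pow, FiberBundle.extend_apply_self,
      ← inner_grad g, smul_eq_mul]
    push_cast
    match_scalars <;> ring
  rw [h.metricTrace_eq (secondCov_isBilinearMap g (hW x)), hzero]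
  simp only [hsecond]
  rw [metricTrace_add, metricTrace_add, metricTrace_add, metricTrace_smul, metricTrace_smul,
    metricTrace_smul, metricTrace_smul_const, metricTrace_add, metricTrace_smul, metricTrace_smul]
  have t1 : (metricTrace g x fun u v =>
      g.inner x (grad g α x) u • leviCivita g (grad g α) x v)
        = leviCivita g (grad g α) x (grad g α x) :=
    metricTrace_inner_smul g (grad g α x) (leviCivita g (grad g α) x).toLinearMap
  have t2 : (metricTrace g x fun u v =>
      g.inner x (grad g α x) v • leviCivita g (grad g α) x u)
        = leviCivita g (grad g α) x (grad g α x) := t1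
  have t3 : (metricTrace g x fun u v =>
      g.inner x (grad g α x) u * g.inner x (grad g α x) v)
        = g.inner x (grad g α x) (grad g α x) :=
    metricTrace_inner_smul g (grad g α x) (g.inner x (grad g α x)).toLinearMap
  rw [t1, t2, t3, roughLaplacian_eq, laplacian]
  simp only [smul_eq_mul]
  module

/-- With `c = m - 1`, the second derivatives of `c α⁻² grad α` contribute `4` and `-6` to the
coefficients of `∇_{grad α} grad α` and `|grad α|² grad α`, while `-∇_τ τ` contributes `-c` and
`2c`. This explains `-(m - 5) = 4 - c` and `2(m - 4) = 2c - 6`. -/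
theorem bitension_id_eq {m : ℕ} (hm : Module.finrank ℝ E = 2 * m) (x : M) :
    bitension g' g (id : M → M) x = (((m : ℝ) - 1) / α x ^ 3) •
      (roughLaplacian g (grad g α) x - ricci g x (grad g α x)
        - (((m : ℝ) - 5) / α x) • leviCivita g (grad g α) x (grad g α x)
        + (2 * (((m : ℝ) - 4) * g.inner x (grad g α x) (grad g α x) / α x ^ 2
            + laplacian g α x / α x)) • grad g α x) := by
  have hα := (h.pos x).ne'
  have hf := h.contMDiff_const_div_pow ((m : ℝ) - 1) 2
  have hG := h.smoothField_grad
  have hτ : tension g' g (id : M → M) = (fun y => ((m : ℝ) - 1) / α y ^ 2) • grad g α :=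
    funext (h.tension_id_eq hm)
  have hW : SmoothField (tension g' g (id : M → M)) := by
    rw [hτ]
    exact fun y => SmoothFieldAt.smul (hf y) (hG y)
  have hR : metricTrace g' x (curvature (leviCivita g) x
      ((((m : ℝ) - 1) / α x ^ 2) • grad g α x))
      = (1 / α x) • (((m : ℝ) - 1) / α x ^ 2) • ricci g x (grad g α x) := by
    have hc : curvature (leviCivita g) x ((((m : ℝ) - 1) / α x ^ 2) • grad g α x)
        = fun u v => (((m : ℝ) - 1) / α x ^ 2) • curvature (leviCivita g) x (grad g α x) u v := by
      funext u v
      exact curvature_smul_left g _ _ _ _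
    -- The `(ξ, ξ)` correction is `R(τ, ξ)ξ`, zero because `ξ` is parallel.
    rw [h.metricTrace_eq (curvature_isBilinearMap g _),
      curvature_apply_parallel g (h.smooth_field x) h.parallel, smul_zero, sub_zero, hc,
      metricTrace_smul]
    rfl
  have hcov : leviCivita g ((fun y => ((m : ℝ) - 1) / α y ^ 2) • grad g α) x
      ((((m : ℝ) - 1) / α x ^ 2) • grad g α x)
      = (((m : ℝ) - 1) / α x ^ 2) • ((((m : ℝ) - 1) / α x ^ 2) •
          leviCivita g (grad g α) x (grad g α x)
        + (-(2 * ((m : ℝ) - 1)) / α x ^ 3 * g.inner x (grad g α x) (grad g α x)) •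
          grad g α x) := by
    rw [map_smul, cov_smul _ ((hf x).mdifferentiableAt (by simp))
      (SmoothFieldAt.mdifferentiableAt (hG x)), h.mvfderiv_const_div_pow, ← inner_grad g]
    push_cast
    rfl
  rw [bitension_id g' g hW, hτ]
  simp only [Pi.smul_apply']
  rw [h.metricTrace_secondCov, hR]
  erw [hcov]
  match_scalars <;> field_simp <;> ring

end IsParallelDeformation

end Deformation

/-! ### Vanishing gradient on a connected manifold -/

section Constant

variable {E : Type*} [NormedAddCommGroup E] [NormedSpace ℝ E] [FiniteDimensional ℝ E]
  {M : Type*} [TopologicalSpace M] [ChartedSpace E M] [IsManifold 𝓘(ℝ, E) ∞ M]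

theorem forall_grad_eq_zero_iff [PreconnectedSpace M] (g : Metric E M) {α : M → ℝ}
    (hα : MDifferentiable 𝓘(ℝ, E) 𝓘(ℝ) α) :
    (∀ x, grad g α x = 0) ↔ ∃ c : ℝ, ∀ x, α x = c := by
  constructor
  · intro h
    refine exists_eq_const_of_mvfderiv_eq_zero hα fun x => ?_
    ext u
    rw [← inner_grad g, h, map_zero]
  · rintro ⟨c, hc⟩ x
    apply inner_injective g x
    ext u
    have h0 : α = fun _ => c := funext hc
    rw [inner_grad, h0, mvfderiv_const, map_zero]

end Constant

end RiemannianMaps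

end

/-! ### The theorem -/

open RiemannianMaps

theorem theorem17 {E : Type*} [NormedAddCommGroup E] [NormedSpace ℝ E] [FiniteDimensional ℝ E]
    {M : Type*} [TopologicalSpace M] [T2Space M] [SecondCountableTopology M]
    [ChartedSpace E M] [IsManifold 𝓘(ℝ, E) ∞ M]
    (m : ℕ) (hm : Module.finrank ℝ E = 2 * m)
    (g : Metric E M)
    (F : Π x : M, TangentSpace 𝓘(ℝ, E) x →L[ℝ] TangentSpace 𝓘(ℝ, E) x)
    (hF : IsParaKahlerNorden g F)
    (V : Π x : M, TangentSpace 𝓘(ℝ, E) x) (hV : SmoothField V)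
    (hV_unit : ∀ x, g.inner x (V x) (V x) = 1)
    (hV_parallel : ∀ x, leviCivita g V x = 0)
    (α : M → ℝ) (hα : ContMDiff 𝓘(ℝ, E) 𝓘(ℝ) ∞ α) (hα_pos : ∀ x, 0 < α x)
    (hFV : ∀ x, mvfderiv 𝓘(ℝ, E) α x (F x (V x)) = 0) :
    (∀ x, bitension (bergerMetric g F V α hF.smooth hV hα hα_pos) g (id : M → M) x
      = (((m : ℝ) - 1) / α x ^ 3) • bracketField m g F V α x)
    ∧ (IsBiharmonic (bergerMetric g F V α hF.smooth hV hα hα_pos) g (id : M → M)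
      ↔ m = 1 ∨ ∀ x, bracketField m g F V α x = 0)
    ∧ (PreconnectedSpace M →
      (IsProperBiharmonic (bergerMetric g F V α hF.smooth hV hα hα_pos) g (id : M → M)
        ↔ (¬ ∃ c : ℝ, ∀ x, α x = c) ∧ m ≠ 1 ∧ ∀ x, bracketField m g F V α x = 0)) := by
  have hξ : SmoothField fun y => F y (V y) := hF.smooth.apply hV
  have hparallel : ∀ x, leviCivita g (fun y => F y (V y)) x = 0 := by
    intro x
    ext u
    rw [hF.parallel V x (hV.smoothFieldAt x).mdifferentiableAt, hV_parallel]
    simp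
  have h : IsParallelDeformation g (bergerMetric g F V α hF.smooth hV hα hα_pos)
      (fun y => F y (V y)) α :=
    { smooth_field := hξ
      -- `g(FV, FV) = g(V, F²V) = g(V, V) = 1`.
      unit := fun x => by rw [hF.pure, hF.involutive, hV_unit]
      parallel := hparallel
      smooth := hα
      pos := hα_pos
      deriv_eq_zero := hFV
      inner_eq := bergerMetric_inner g F V α hF.smooth hV hα hα_pos }
  have hbitension : ∀ x, bitension (bergerMetric g F V α hF.smooth hV hα hα_pos) g (id : M → M) x
      = (((m : ℝ) - 1) / α x ^ 3) • bracketField m g F V α x := by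
    intro x
    -- The inner derivative in `∇_{FV} ∇_{FV} grad α` is already identically zero, so `B` equals the
    -- bracket of `bitension_id_eq`.
    have hlast : (fun y => leviCivita g (grad g α) y (F y (V y))) = fun y => 0 :=
      funext h.leviCivita_grad_field
    rw [h.bitension_id_eq hm, bracketField, hlast, cov_zero_field, smul_zero, sub_zero]
  have hone : (m : ℝ) - 1 = 0 ↔ m = 1 := by rw [sub_eq_zero, Nat.cast_eq_one]
  have hbiharmonic : IsBiharmonic (bergerMetric g F V α hF.smooth hV hα hα_pos) g (id : M → M)
      ↔ m = 1 ∨ ∀ x, bracketField m g F V α x = 0 := by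
    have hiff : ∀ x, bitension (bergerMetric g F V α hF.smooth hV hα hα_pos) g (id : M → M) x = 0
        ↔ m = 1 ∨ bracketField m g F V α x = 0 := by
      intro x
      rw [hbitension, ← hone]
      refine smul_eq_zero.trans (or_congr_left ?_)
      rw [div_eq_zero_iff, or_iff_left (pow_ne_zero 3 (hα_pos x).ne')]
    rw [IsBiharmonic, and_iff_right contMDiff_id, ← forall_or_left]
    exact forall_congr' hiff
  refine ⟨hbitension, hbiharmonic, fun hM => ?_⟩
  -- Connectedness is needed only here, to pass from `grad α = 0` to a constant `α`.
  have hharmonic : IsHarmonic (bergerMetric g F V α hF.smooth hV hα hα_pos) g (id : M → M)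
      ↔ m = 1 ∨ ∃ c : ℝ, ∀ x, α x = c := by
    rw [IsHarmonic, and_iff_right contMDiff_id, ← forall_grad_eq_zero_iff g h.mdifferentiableAt,
      ← hone, ← forall_or_left]
    refine forall_congr' fun x => ?_
    rw [h.tension_id_eq hm]
    refine smul_eq_zero.trans (or_congr_left ?_)
    rw [div_eq_zero_iff, or_iff_left (pow_ne_zero 2 (hα_pos x).ne')]
  rw [IsProperBiharmonic, hbiharmonic, hharmonic]
  tauto
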